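/- An affine variety is an affine integral scheme of finite type over $\mathbb{C}$. A $\mathbb{C}^+$-action on a variety $X$ is a morphism $\phi:\mathbb{C}\times X\to X$ over $\mathbb{C}$ with $\phi(0,x)=x$ and $\phi(c+d,x)=\phi(c,\phi(d,x))$; it is non-trivial if it is not the projection to $X$. For an affine variety $X$ with ring of regular functions $\mathcal{O}(X)$, let $ML(X)\subseteq\mathcal{O}(X)$ be the intersection of the kernels of all locally nilpotent $\mathbb{C}$-derivations of $\mathcal{O}(X)$. An algebraic line bundle is a triple $(L,\pi,X)$, where $L$ and $X$ are affine varieties and $\pi:L\to X$ is a morphism of varieties such that $X$ is covered by Zariski open affine subsets $U_\alpha$ with functions $t_\alpha\in\mathcal{O}(\pi^{-1}(U_\alpha))$ for which $(\pi,t_\alpha):\pi^{-1}(U_\alpha)\to U_\alpha\times\mathbb{C}$ is an isomorphism, and, for all $\alpha,\beta$, $t_\alpha=g_{\alpha\beta}t_\beta$ on $\pi^{-1}(U_\alpha\cap U_\beta)$ for some nowhere vanishing regular function $g_{\alpha\beta}$ on $U_\alpha\cap U_\beta$. Let $(L,\pi,X)$ be an algebraic line bundle over an affine variety $X$. (1)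 If $X$ is smooth, then for every $\mathbb{C}^+$-action $\phi$ on $X$ there is a non-trivial $\mathbb{C}^+$-action $\phi'$ on the total space $L$ such that the image under $\pi$ of a general orbit of $\phi'$ is a generic orbit of $\phi$. That is, for every dense open $V\subseteq X$ there is a dense open $W\subseteq L$ such that for every point $l\in W$ one has $\pi(l)\in V$, and $\pi$ maps the orbit of $\phi'$ through $l$ onto the orbit of $\phi$ through $\pi(l)$. (2) If $ML(X)=\mathbb{C}$, then $ML(L)=\mathbb{C}$. -/

import Mathlib

open CategoryTheory AlgebraicGeometry

noncomputable section

namespace LineBundleML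

/-- The base `Spec ℂ`. -/
abbrev SpecC : Scheme.{0} := Spec (CommRingCat.of ℂ)

/-- An affine complex algebraic variety: an affine integral scheme of finite type over `ℂ`. -/
class IsAffineVariety (X : Scheme.{0}) [X.Over SpecC] : Prop where
  isAffine : IsAffine X
  isIntegral : IsIntegral X
  locallyOfFiniteType : LocallyOfFiniteType (X ↘ SpecC)

attribute [instance] IsAffineVariety.isAffine IsAffineVariety.isIntegral
  IsAffineVariety.locallyOfFiniteType

/-! ### The Makar-Limanov invariant -/

/-- A derivation `D` is locally nilpotent if every element is killed by some power of `D`. -/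
def IsLND {k A : Type*} [CommRing k] [CommRing A] [Algebra k A] (D : Derivation k A A) : Prop :=
  ∀ a : A, ∃ n : ℕ, D^[n] a = 0

/-- `ML(A)`: the intersection of the kernels of all locally nilpotent `k`-derivations of `A`. -/
def makarLimanov (k A : Type*) [CommRing k] [CommRing A] [Algebra k A] : Subalgebra k A where
  carrier := {a | ∀ D : Derivation k A A, IsLND D → D a = 0}
  mul_mem' := fun ha hb D hD => by rw [D.leibniz, ha D hD, hb D hD, smul_zero, smul_zero, add_zero]
  add_mem' := fun ha hb D hD => by rw [map_add, ha D hD, hb D hD, add_zero]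
  algebraMap_mem' := fun r D _ => D.map_algebraMap r

/-- The `ℂ`-algebra structure of `𝒪(X) = Γ(X, ⊤)` given by the structure morphism
`X ⟶ Spec ℂ`. -/
instance sectionsAlgebra (X : Scheme.{0}) [X.Over SpecC] : Algebra ℂ Γ(X, ⊤) :=
  ((Scheme.ΓSpecIso (CommRingCat.of ℂ)).inv ≫ (X ↘ SpecC).appTop).hom.toAlgebra

/-- `ML(X) = ML(𝒪(X))`, as a `ℂ`-subalgebra of `𝒪(X)`. -/
def ML (X : Scheme.{0}) [X.Over SpecC] : Subalgebra ℂ Γ(X, ⊤) :=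
  makarLimanov ℂ Γ(X, ⊤)

/-! ### Algebraic `ℂ⁺`-actions -/

/-- The `T`-point `(c, x)` of `ℂ × X`, where `ℂ × X` is realised as the affine line
`𝔸(PUnit; X)` over `X`. -/
def linePoint {X T : Scheme.{0}} (c : Γ(T, ⊤)) (x : T ⟶ X) : T ⟶ 𝔸(PUnit; X) :=
  AffineSpace.homOfVector x (fun _ => c)

/-- An algebraic action of the additive group `ℂ⁺` on `X`: a morphism `ℂ × X ⟶ X` over `ℂ`
such that, for points with values in any scheme `T`, `0 · x = x` and
`(c + d) · x = c · (d · x)`. -/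
structure GaAction (X : Scheme.{0}) [X.Over SpecC] where
  hom : 𝔸(PUnit; X) ⟶ X
  hom_over : hom ≫ (X ↘ SpecC) = (𝔸(PUnit; X) ↘ X) ≫ (X ↘ SpecC)
  zero_act : ∀ (T : Scheme.{0}) (x : T ⟶ X), linePoint 0 x ≫ hom = x
  add_act : ∀ (T : Scheme.{0}) (c d : Γ(T, ⊤)) (x : T ⟶ X),
    linePoint (c + d) x ≫ hom = linePoint c (linePoint d x ≫ hom) ≫ hom

/-- The action is non-trivial if it is not the projection `ℂ × X ⟶ X`. -/
def GaAction.Nontrivial {X : Scheme.{0}} [X.Over SpecC] (φ : GaAction X) : Prop :=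
  φ.hom ≠ 𝔸(PUnit; X) ↘ X

/-- The `ℂ`-points of `X`, that is, the points of the variety `X` in the classical sense. -/
def cPoints (X : Scheme.{0}) [X.Over SpecC] : Set (SpecC ⟶ X) :=
  {x | x ≫ (X ↘ SpecC) = 𝟙 SpecC}

/-- A point `x` belongs to the open subset `U`. -/
def PointIn {X : Scheme.{0}} (x : SpecC ⟶ X) (U : X.Opens) : Prop :=
  Set.range x ⊆ (U : Set X)

/-- The orbit `{c · x | c ∈ ℂ}` of the point `x`. -/
def GaAction.orbit {X : Scheme.{0}} [X.Over SpecC] (φ : GaAction X) (x : SpecC ⟶ X) :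
    Set (SpecC ⟶ X) :=
  Set.range fun c : ℂ =>
    linePoint ((Scheme.ΓSpecIso (CommRingCat.of ℂ)).inv.hom c) x ≫ φ.hom

/-- The image under `π` of a general orbit of `φ'` is a generic orbit of `φ`: for each dense open
`V ⊆ X` there is a dense open `W ⊆ L` such that the orbit of `φ'` through any point `l` of `W` is
mapped by `π` onto the orbit of `φ` through `π(l)`, and `π(l) ∈ V`. -/
def GeneralOrbitsProjectOntoGeneric {L X : Scheme.{0}} [L.Over SpecC] [X.Over SpecC]
    (π : L ⟶ X) (φ' : GaAction L) (φ : GaAction X) : Prop :=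
  ∀ V : X.Opens, Dense (V : Set X) → ∃ W : L.Opens, Dense (W : Set L) ∧
    ∀ l ∈ cPoints L, PointIn l W →
      PointIn (l ≫ π) V ∧ (fun y => y ≫ π) '' φ'.orbit l = φ.orbit (l ≫ π)

/-! ### Algebraic line bundles -/

/-- The morphism `(π, t) : π⁻¹(U) ⟶ U × ℂ` attached to a function `t` on `π⁻¹(U)`. -/
def localTriv {L X : Scheme.{0}} (π : L ⟶ X) (U : X.Opens) (t : Γ(L, π ⁻¹ᵁ U)) :
    (π ⁻¹ᵁ U).toScheme ⟶ 𝔸(PUnit; U.toScheme) :=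
  linePoint ((π ⁻¹ᵁ U).topIso.inv.hom t) (π ∣_ U)

/-- `(L, π, X)` is an algebraic line bundle: `L` and `X` are affine varieties, `π : L ⟶ X` is a
morphism of varieties, and `X` is covered by affine open sets `U i` with coordinates
`t i ∈ 𝒪(π⁻¹(U i))` such that `(π, t i) : π⁻¹(U i) ⟶ U i × ℂ` is an isomorphism, and on
`π⁻¹(U i ∩ U j)` one has `t i = g · t j` for a nowhere vanishing regular function `g` on
`U i ∩ U j`. -/
structure IsLineBundle {L X : Scheme.{0}} [L.Over SpecC] [X.Over SpecC] [IsAffineVariety L]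
    [IsAffineVariety X] (π : L ⟶ X) : Prop where
  comp_hom : π ≫ (X ↘ SpecC) = L ↘ SpecC
  exists_triv : ∃ (ι : Type) (U : ι → X.Opens) (t : ∀ i, Γ(L, π ⁻¹ᵁ U i)),
    (∀ i, IsAffineOpen (U i)) ∧ (⨆ i, U i = ⊤) ∧
    (∀ i, IsIso (localTriv π (U i) (t i))) ∧
    ∀ i j, ∃ g : Γ(X, U i ⊓ U j), IsUnit g ∧
      L.presheaf.map (homOfLE (π.preimage_mono inf_le_left)).op (t i) =
        π.app (U i ⊓ U j) g *
          L.presheaf.map (homOfLE (π.preimage_mono inf_le_right)).op (t j)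

end LineBundleML

end

namespace LineBundleML

open Polynomial

/-! ### Locally nilpotent derivations -/

section Derivations

variable {k A : Type*} [CommRing k] [CommRing A] [Algebra k A]

/-! Put A = 𝒪(X) and B = 𝒪(L), and let D be a locally nilpotent derivation of A. Inverting the
nonzero elements of ker D turns A into a field or a polynomial ring in one variable over a field, so
ideals become principal (`exists_generator_over_kernel`). Applied to an ideal that represents the
functions on L linear along the fibres, this trivialises the bundle over D(h) for some h in ker D:
B[1/h] = A[1/h][e] (`exists_isCoordinate_over_kernel`). Extend D by D e = 0. As B is finitely
generated, multiplying by a power of h clears denominators, and local nilpotency survives because D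
h = 0 (`exists_derivation_extension`, `exists_derivation_lift`). The same device applied to d/dt
gives a derivation of B with kernel exactly A (`exists_vertical_derivation`).

For the invariant: the vertical derivation forces ML(L) into A, and the lifts then force it into
ML(X). For actions: they are the exponentials of locally nilpotent derivations
(`GaAction.exists_expPoly`, `expAction`), and a lift of h D, with D h = 0, moves π(l) along its old
orbit with time rescaled by h(π(l)). The orbit is unchanged as a set wherever h is nonzero
(`image_orbit_expAction`). -/

theorem iterate_derivation_add (D : Derivation k A A) (n : ℕ) (a b : A) :
    D^[n] (a + b) = D^[n] a + D^[n] b := by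
  induction n generalizing a b with
  | zero => rfl
  | succ n ih => simp only [Function.iterate_succ_apply, map_add, ih]

theorem iterate_derivation_zero (D : Derivation k A A) (n : ℕ) : D^[n] 0 = 0 :=
  Function.iterate_fixed (map_zero D) n

theorem iterate_derivation_sub (D : Derivation k A A) (n : ℕ) (a b : A) :
    D^[n] (a - b) = D^[n] a - D^[n] b := by
  induction n generalizing a b with
  | zero => rfl
  | succ n ih => simp only [Function.iterate_succ_apply, map_sub, ih]

theorem iterate_derivation_eq_zero_of_le (D : Derivation k A A) {m n : ℕ} (hmn : m ≤ n) {a : A}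
    (ha : D^[m] a = 0) : D^[n] a = 0 := by
  obtain ⟨d, rfl⟩ := Nat.exists_eq_add_of_le hmn
  rw [add_comm, Function.iterate_add_apply, ha, iterate_derivation_zero]

theorem iterate_derivation_mul_of_eq_zero (D : Derivation k A A) {c : A} (hc : D c = 0) (n : ℕ)
    (a : A) : D^[n] (c * a) = c * D^[n] a := by
  induction n generalizing a with
  | zero => rfl
  | succ n ih => simp [Function.iterate_succ_apply, hc, ih]

theorem iterate_derivation_mul (D : Derivation k A A) (n : ℕ) (a b : A) :
    D^[n] (a * b) = ∑ ij ∈ Finset.HasAntidiagonal.antidiagonal n,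
      n.choose ij.1 • (D^[ij.1] a * D^[ij.2] b) := by
  induction n with
  | zero => simp
  | succ n ih =>
    rw [Finset.sum_antidiagonal_choose_succ_nsmul (M := A) (fun i j => D^[i] a * D^[j] b) n,
      Function.iterate_succ_apply', ih, map_sum, ← Finset.sum_add_distrib]
    refine Finset.sum_congr rfl fun ij hij => ?_
    obtain ⟨i, j⟩ := ij
    have hij' : i + j = n := Finset.HasAntidiagonal.mem_antidiagonal.1 hij
    have : n.choose j = n.choose i := by
      rw [← hij', Nat.choose_symm_add]
    simp only [map_nsmul, Derivation.leibniz, Function.iterate_succ_apply', smul_eq_mul, nsmul_add,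
      this]
    rw [mul_comm (D^[j] b)]

/-- The derivation of `A[X]` that applies `D` to the coefficients. -/
noncomputable def coeffDerivation (D : Derivation k A A) : Derivation k A[X] A[X] :=
  -- The range of summation depends on the degree, so additivity and the Leibniz rule are checked
  -- through this coefficient formula.
  have key : ∀ (p : A[X]) (n : ℕ),
      (∑ i ∈ Finset.range (p.natDegree + 1), monomial i (D (p.coeff i))).coeff n =
        D (p.coeff n) := by
    intro p n
    simp only [finsetSum_coeff, coeff_monomial, Finset.sum_ite_eq', Finset.mem_range]
    split_ifs with h
    · rfl
    · rw [coeff_eq_zero_of_natDegree_lt (by omega), map_zero]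
  Derivation.mk'
    { toFun := fun p => ∑ i ∈ Finset.range (p.natDegree + 1), monomial i (D (p.coeff i))
      map_add' := fun p q => by
        ext n
        rw [key, coeff_add, coeff_add, key, key, map_add]
      map_smul' := fun c p => by
        ext n
        rw [key, RingHom.id_apply, coeff_smul, coeff_smul, key, Derivation.map_smul] }
    (fun p q => by
      ext n
      change (∑ i ∈ Finset.range ((p * q).natDegree + 1), monomial i (D ((p * q).coeff i))).coeff n
        = (p * (∑ i ∈ Finset.range (q.natDegree + 1), monomial i (D (q.coeff i))) +
          q * (∑ i ∈ Finset.range (p.natDegree + 1), monomial i (D (p.coeff i)))).coeff n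
      rw [key, mul_comm q, coeff_add]
      simp only [coeff_mul, key, map_sum, Derivation.leibniz, Finset.sum_add_distrib, smul_eq_mul]
      congr 1
      exact Finset.sum_congr rfl fun _ _ => mul_comm _ _)

theorem coeff_coeffDerivation (D : Derivation k A A) (p : A[X]) (n : ℕ) :
    (coeffDerivation D p).coeff n = D (p.coeff n) := by
  change (∑ i ∈ Finset.range (p.natDegree + 1), monomial i (D (p.coeff i))).coeff n = _
  simp only [finsetSum_coeff, coeff_monomial, Finset.sum_ite_eq', Finset.mem_range]
  split_ifs with h
  · rfl
  · rw [coeff_eq_zero_of_natDegree_lt (by omega), map_zero]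

theorem coeffDerivation_C (D : Derivation k A A) (a : A) :
    coeffDerivation D (C a) = C (D a) := by
  ext n
  rw [coeff_coeffDerivation, coeff_C, coeff_C]
  split_ifs <;> simp

theorem IsLND.coeffDerivation {D : Derivation k A A} (hD : IsLND D) :
    IsLND (coeffDerivation D) := by
  intro p
  choose N hN using hD
  have key : ∀ (n : ℕ) (p : A[X]) (i : ℕ),
      ((LineBundleML.coeffDerivation D)^[n] p).coeff i = D^[n] (p.coeff i) := by
    intro n
    induction n with
    | zero => intros; rfl
    | succ n ih => intro p i; simp only [Function.iterate_succ_apply, ih, coeff_coeffDerivation]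
  refine ⟨(Finset.range (p.natDegree + 1)).sup fun i => N (p.coeff i), ?_⟩
  ext i
  rw [key, coeff_zero]
  by_cases hi : i < p.natDegree + 1
  · exact iterate_derivation_eq_zero_of_le D (Finset.le_sup (f := fun i => N (p.coeff i))
      (Finset.mem_range.2 hi)) (hN _)
  · rw [coeff_eq_zero_of_natDegree_lt (by omega), iterate_derivation_zero]

/-- A locally nilpotent derivation `δ` of `R` extends, after multiplication by a power of an element
`h` of its kernel, to every algebra of finite type between `R` and `R[1/h]`. -/
theorem exists_derivation_extension {R B : Type*} [CommRing R] [CommRing B] [IsDomain B]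
    [Algebra k R] [Algebra k B] [Algebra.FiniteType k B] (j : R →ₐ[k] B)
    (hj : Function.Injective j) (δ : Derivation k R R) (hδ : IsLND δ) {h : R} (h0 : h ≠ 0)
    (hh : δ h = 0) (hB : ∀ b, ∃ (n : ℕ) (r : R), j r = j h ^ n * b) :
    ∃ (N : ℕ) (D : Derivation k B B), IsLND D ∧ ∀ r, D (j r) = j (h ^ N * δ r) := by
  have hjh : j h ≠ 0 := (map_ne_zero_iff j hj).2 h0
  have hpow : ∀ n, δ (h ^ n) = 0 := fun n => by rw [Derivation.leibniz_pow, hh]; simp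
  -- The graph of h ^ N δ on fractions: if b = r / h ^ n then δ b = δ r / h ^ n, because h is a
  -- constant of δ. This avoids constructing the localization.
  let P : ℕ → B → B → Prop := fun N b y =>
    ∃ (n : ℕ) (r : R), j r = j h ^ n * b ∧ j h ^ n * y = j (h ^ N * δ r)
  have huniq : ∀ N b y y', P N b y → P N b y' → y = y' := by
    rintro N b y y' ⟨n, r, hr, hy⟩ ⟨n', r', hr', hy'⟩
    have h1 : h ^ n' * r = h ^ n * r' := by
      apply hj
      simp only [map_mul, map_pow, hr, hr']
      ring
    have h2 : h ^ n' * δ r = h ^ n * δ r' := by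
      simpa [hpow] using congrArg δ h1
    apply mul_left_cancel₀ (pow_ne_zero (n + n') hjh)
    calc j h ^ (n + n') * y = j (h ^ n') * (j h ^ n * y) := by rw [map_pow]; ring
      _ = j (h ^ N * (h ^ n' * δ r)) := by rw [hy, ← map_mul]; congr 1; ring
      _ = j (h ^ n) * (j h ^ n' * y') := by rw [h2, hy', ← map_mul]; congr 1; ring
      _ = _ := by rw [map_pow]; ring
  have hR : ∀ N r, P N (j r) (j (h ^ N * δ r)) := fun N r => ⟨0, r, by simp, by simp⟩
  have hadd : ∀ N b b' y y', P N b y → P N b' y' → P N (b + b') (y + y') := by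
    rintro N b b' y y' ⟨n, r, hr, hy⟩ ⟨n', r', hr', hy'⟩
    refine ⟨n + n', h ^ n' * r + h ^ n * r', ?_, ?_⟩
    · simp only [map_add, map_mul, map_pow, hr, hr']; ring
    · simp only [map_add, Derivation.leibniz, hpow, smul_eq_mul, mul_zero, add_zero] at *
      have e : h ^ N * (h ^ n' * δ r + h ^ n * δ r') =
        h ^ n' * (h ^ N * δ r) + h ^ n * (h ^ N * δ r') := by ring
      rw [e, map_add, map_mul, map_mul _ (h ^ n), ← hy, ← hy']
      simp only [map_pow]; ring
  have hmul : ∀ N b b' y y', P N b y → P N b' y' → P N (b * b') (b * y' + b' * y) := by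
    rintro N b b' y y' ⟨n, r, hr, hy⟩ ⟨n', r', hr', hy'⟩
    refine ⟨n + n', r * r', ?_, ?_⟩
    · simp only [map_mul, hr, hr']; ring
    · have e : h ^ N * δ (r * r') = r * (h ^ N * δ r') + r' * (h ^ N * δ r) := by
        simp only [Derivation.leibniz, smul_eq_mul]; ring
      rw [e, map_add, map_mul, map_mul _ r', ← hy, ← hy', hr, hr']
      ring
  obtain ⟨s, hs⟩ := (inferInstance : Algebra.FiniteType k B).out
  choose n r hr using hB
  -- Large enough to clear the denominators of all the generators; the Leibniz rule then handles the
  -- rest of B.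
  let N := s.sup n
  have hall : ∀ b, ∃ y, P N b y := by
    intro b
    have hb : b ∈ Algebra.adjoin k (s : Set B) := hs ▸ Algebra.mem_top
    induction hb using Algebra.adjoin_induction with
    | mem x hx =>
      have hle : n x ≤ N := Finset.le_sup (f := n) hx
      refine ⟨j (h ^ (N - n x) * δ (r x)), n x, r x, hr x, ?_⟩
      rw [← map_pow, ← map_mul, ← mul_assoc, ← pow_add, Nat.add_sub_cancel' hle]
    | algebraMap c => exact ⟨_, by simpa using hR N (algebraMap k R c)⟩
    | add x y _ _ hx hy =>
      obtain ⟨x', hx⟩ := hx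
      obtain ⟨y', hy⟩ := hy
      exact ⟨_, hadd _ _ _ _ _ hx hy⟩
    | mul x y _ _ hx hy =>
      obtain ⟨x', hx⟩ := hx
      obtain ⟨y', hy⟩ := hy
      exact ⟨_, hmul _ _ _ _ _ hx hy⟩
  choose d hd using hall
  have dR : ∀ r, d (j r) = j (h ^ N * δ r) := fun r => huniq N _ _ _ (hd _) (hR N r)
  have dmul : ∀ a b, d (a * b) = a * d b + b * d a := fun a b =>
    huniq N _ _ _ (hd _) (hmul _ _ _ _ _ (hd a) (hd b))
  let D : Derivation k B B := Derivation.mk'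
    { toFun := d
      map_add' := fun a b => huniq N _ _ _ (hd _) (hadd _ _ _ _ _ (hd a) (hd b))
      map_smul' := fun c b => by
        have : d (algebraMap k B c) = 0 := by
          rw [← j.commutes, dR, Derivation.map_algebraMap, mul_zero, map_zero]
        rw [RingHom.id_apply, Algebra.smul_def, dmul, this, mul_zero, add_zero, Algebra.smul_def] }
    dmul
  have DR : ∀ r, D (j r) = j (h ^ N * δ r) := dR
  refine ⟨N, D, fun b => ?_, DR⟩
  have hDh : ∀ n, D (j h ^ n) = 0 := fun n => by rw [← map_pow, DR, hpow, mul_zero, map_zero]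
  -- Nilpotency is inherited from R: some h ^ n b lies in R, and the constant h ^ n can be
  -- cancelled.
  have hiter : ∀ m r, D^[m] (j r) = j (h ^ (N * m) * δ^[m] r) := by
    intro m
    induction m with
    | zero => simp
    | succ m ih =>
      intro r
      rw [Function.iterate_succ_apply, DR, ih, Function.iterate_succ_apply,
        iterate_derivation_mul_of_eq_zero δ (hpow N), ← mul_assoc, ← pow_add, Nat.mul_succ]
  obtain ⟨m, hm⟩ := hδ (r b)
  refine ⟨m, ?_⟩
  have := hiter m (r b)
  rw [hm, mul_zero, map_zero, hr, iterate_derivation_mul_of_eq_zero D (hDh _)] at this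
  exact (mul_eq_zero.1 this).resolve_left (pow_ne_zero _ hjh)

end Derivations

/-- An ideal becomes principal after inverting the nonzero elements of the kernel of a locally
nilpotent derivation. -/
theorem exists_generator_over_kernel {k A : Type*} [CommRing k] [CommRing A] [IsDomain A]
    [Algebra k A] [CharZero A] {D : Derivation k A A} (hD : IsLND D) (I : Ideal A) (hI : I ≠ ⊥) :
    ∃ a₀ ∈ I, a₀ ≠ 0 ∧ ∀ a ∈ I, ∃ h q : A, h ≠ 0 ∧ D h = 0 ∧ h * a = q * a₀ := by
  obtain ⟨b, hbI, hb⟩ := Submodule.exists_mem_ne_zero_of_ne_bot hI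
  -- The exponent m + 1 makes the least m the D-degree of a₀, so that D^m(a₀) is a nonzero constant:
  -- the leading coefficient for a division by a₀.
  have hex : ∃ m : ℕ, ∃ a ∈ I, a ≠ 0 ∧ D^[m + 1] a = 0 := by
    obtain ⟨m, hm⟩ := hD b
    exact ⟨m, b, hbI, hb, iterate_derivation_eq_zero_of_le D (Nat.le_succ m) hm⟩
  classical
  obtain ⟨a₀, ha₀I, ha₀, hm⟩ := Nat.find_spec hex
  have hmin := fun i hi => Nat.find_min (H := hex) (m := i) hi
  set m := Nat.find hex
  have hlow : ∀ n, n ≤ m → ∀ a ∈ I, D^[n] a = 0 → a = 0 := by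
    intro n hn a ha h
    by_contra hne
    rcases n with _ | n
    · exact hne h
    · exact hmin n hn ⟨a, ha, hne, h⟩
  have hβ : D^[m] a₀ ≠ 0 := fun h => ha₀ (hlow m le_rfl a₀ ha₀I h)
  have hDβ : D (D^[m] a₀) = 0 := (Function.iterate_succ_apply' D m a₀).symm.trans hm
  refine ⟨a₀, ha₀I, ha₀, ?_⟩
  have main : ∀ n, ∀ a ∈ I, D^[n] a = 0 → ∃ h q : A, h ≠ 0 ∧ D h = 0 ∧ h * a = q * a₀ := by
    intro n
    induction n with
    | zero => exact fun a _ h => ⟨1, 0, one_ne_zero, D.map_one_eq_zero, by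
        rw [Function.iterate_zero_apply] at h; simp [h]⟩
    | succ n ih =>
      intro a ha h
      by_cases hnm : n < m
      · exact ⟨1, 0, one_ne_zero, D.map_one_eq_zero, by simp [hlow (n + 1) hnm a ha h]⟩
      obtain ⟨d, rfl⟩ := Nat.exists_eq_add_of_le (not_lt.1 hnm)
      -- One step of division by a₀. In the Leibniz expansion of D^(m+d)(D^m(a) a₀) only the term
      -- (d, m) survives, since D^m(a) has degree at most d and a₀ has degree m. Hence c a and
      -- D^m(a) a₀ have the same leading term, and c is nonzero by characteristic zero.
      set c : A := ((m + d).choose d : ℕ) * D^[m] a₀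
      have hc : c ≠ 0 := mul_ne_zero (Nat.cast_ne_zero.2 (Nat.choose_pos (by omega)).ne') hβ
      have hDc : D c = 0 := by simp [c, hDβ]
      have key : D^[m + d] (D^[m] a * a₀) =
          ((m + d).choose d : ℕ) * (D^[d] (D^[m] a) * D^[m] a₀) := by
        rw [iterate_derivation_mul, Finset.sum_eq_single (d, m)]
        · simp
        · rintro ⟨i, j⟩ hij hne
          have hij : i + j = m + d := Finset.HasAntidiagonal.mem_antidiagonal.1 hij
          rcases lt_trichotomy j m with hj | hj | hj
          · have : D^[i] (D^[m] a) = 0 := by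
              rw [← Function.iterate_add_apply]
              exact iterate_derivation_eq_zero_of_le D (by omega) h
            simp [this]
          · exact absurd (Prod.ext (by simp; omega) hj) hne
          · have : D^[j] a₀ = 0 := iterate_derivation_eq_zero_of_le D hj hm
            simp [this]
        · intro hne
          exact absurd (Finset.HasAntidiagonal.mem_antidiagonal.2 (add_comm d m)) hne
      have hz : D^[m + d] (c * a - D^[m] a * a₀) = 0 := by
        rw [iterate_derivation_sub, iterate_derivation_mul_of_eq_zero D hDc, key,
          ← Function.iterate_add_apply, add_comm d m]
        ring
      obtain ⟨h', q, hh', hDh', e⟩ := ih (c * a - D^[m] a * a₀)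
        (I.sub_mem (I.mul_mem_left _ ha) (I.mul_mem_left _ ha₀I)) hz
      refine ⟨h' * c, q + h' * D^[m] a, mul_ne_zero hh' hc, by simp [hDh', hDc], ?_⟩
      linear_combination e
  intro a ha
  obtain ⟨n, hn⟩ := hD a
  exact main n a ha hn

/-! ### Coordinates of line bundles over basic open sets -/

/-- `t` is a coordinate of the `A`-algebra `B` over `D(f)`: `B[1/f]` is the polynomial ring
`A[1/f][t]`. -/
structure IsCoordinate {A B : Type*} [CommRing A] [CommRing B] [Algebra A B] (f : A) (t : B) :
    Prop where
  ne_zero : f ≠ 0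
  transcendental : Transcendental A t
  exists_pow_smul_eq : ∀ b : B, ∃ (n : ℕ) (p : A[X]), aeval t p = f ^ n • b

section Coordinates

variable {A B : Type*} [CommRing A] [CommRing B] [Algebra A B]

theorem IsCoordinate.aeval_injective {f : A} {t : B} (h : IsCoordinate f t) :
    Function.Injective (aeval t : A[X] →ₐ[A] B) :=
  transcendental_iff_injective.1 h.transcendental

theorem IsCoordinate.algebraMap_injective {f : A} {t : B} (h : IsCoordinate f t) :
    Function.Injective (algebraMap A B) := by
  intro a b hab
  have : (C a : A[X]) = C b := h.aeval_injective (by simpa using hab)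
  exact C_injective this

/-- If `u t = y e`, then `u ^ d P(t)` is a polynomial in `e`, where `d` is the degree of `P`. -/
theorem smul_aeval_mem_adjoin {u y : A} {t e : B} (h : u • t = y • e) (P : A[X]) :
    u ^ P.natDegree • aeval t P ∈ Algebra.adjoin A {e} := by
  rw [aeval_eq_sum_range, Finset.smul_sum]
  refine Subalgebra.sum_mem _ fun i hi => ?_
  have hi : i ≤ P.natDegree := Nat.lt_succ_iff.1 (Finset.mem_range.1 hi)
  have : u ^ P.natDegree • P.coeff i • t ^ i =
      (u ^ (P.natDegree - i) * P.coeff i * y ^ i) • e ^ i := by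
    have e1 : u ^ i • t ^ i = y ^ i • e ^ i := by rw [← _root_.smul_pow, h, _root_.smul_pow]
    rw [mul_smul, ← e1, ← mul_smul, ← mul_smul]
    congr 1
    rw [mul_right_comm, ← pow_add, Nat.sub_add_cancel hi]
  rw [this]
  exact Subalgebra.smul_mem _ (Subalgebra.pow_mem _ (Algebra.self_mem_adjoin_singleton _ _) _) _

variable [IsDomain A] [IsDomain B] {ι : Type*} {f : ι → A} {t : ι → B}

/-- A line bundle is trivial over the basic open set of an element of the kernel of a locally
nilpotent derivation of the base. -/
theorem exists_isCoordinate_over_kernel {k : Type*} [CommRing k] [Algebra k A] [CharZero A]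
    [Finite ι] (hf : Ideal.span (Set.range f) = ⊤) (ht : ∀ i, IsCoordinate (f i) (t i))
    (htrans : ∀ i j, ∃ (n : ℕ) (a : A), (f i * f j) ^ n • t i = a • t j)
    {D : Derivation k A A} (hD : IsLND D) :
    ∃ (h : A) (e : B), D h = 0 ∧ IsCoordinate h e := by
  classical
  cases nonempty_fintype ι
  -- Membership in a submodule is local on the cover by the D(f i).
  have hloc : ∀ (M : Submodule A B) (x : B), (∀ i, ∃ n : ℕ, f i ^ n • x ∈ M) → x ∈ M := by
    intro M x hx
    refine Submodule.mem_of_span_eq_top_of_smul_pow_mem M _ hf x ?_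
    rintro ⟨_, i, rfl⟩
    exact hx i
  obtain ⟨i₀⟩ : Nonempty ι := by
    by_contra hne
    rw [not_nonempty_iff] at hne
    rw [Set.range_eq_empty, Ideal.span_empty] at hf
    exact bot_ne_top hf
  have hinj := (ht i₀).algebraMap_injective
  have : FaithfulSMul A B := (faithfulSMul_iff_algebraMap_injective A B).2 hinj
  have hf0 := fun i => (ht i).ne_zero
  have ht0 : ∀ i, t i ≠ 0 := fun i => fun h => (ht i).transcendental (h ▸ isAlgebraic_zero)
  choose n a ha using htrans
  let N := (Finset.univ : Finset (ι × ι)).sup fun p => n p.1 p.2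
  obtain ⟨a, ha⟩ : ∃ a : ι → ι → A, ∀ i j, (f i * f j) ^ N • t i = a i j • t j := by
    refine ⟨fun i j => (f i * f j) ^ (N - n i j) * a i j, fun i j => ?_⟩
    have hle : n i j ≤ N := Finset.le_sup (f := fun p : ι × ι => n p.1 p.2)
      (Finset.mem_univ (i, j))
    rw [mul_smul, ← ha, ← mul_smul, ← pow_add, Nat.sub_add_cancel hle]
  -- Common denominator that expresses the linear coordinates in terms of the single one t i₀.
  let c := f i₀ ^ N
  have hc : c ≠ 0 := pow_ne_zero _ (hf0 _)
  have hc' : ∀ i, (f i ^ N * c) • t i = a i i₀ • t i₀ := fun i => by rw [← ha, mul_pow]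
  -- Those x for which (x / c) t i₀ is, over every D(f i), a multiple of t i: a copy inside A of the
  -- module of functions linear along the fibres.
  let I : Ideal A :=
    { carrier := {x | ∀ i, ∃ (n : ℕ) (y : A), (f i ^ n * x) • t i₀ = (c * y) • t i}
      add_mem' := by
        intro x x' hx hx' i
        obtain ⟨n, y, h⟩ := hx i
        obtain ⟨n', y', h'⟩ := hx' i
        refine ⟨n + n', f i ^ n' * y + f i ^ n * y', ?_⟩
        calc _ = f i ^ n' • ((f i ^ n * x) • t i₀) + f i ^ n • ((f i ^ n' * x') • t i₀) := by
              simp only [← mul_smul, ← add_smul]; congr 1; ring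
          _ = _ := by
            rw [h, h']
            simp only [← mul_smul, ← add_smul]; congr 1; ring
      zero_mem' := fun i => ⟨0, 0, by simp⟩
      smul_mem' := by
        intro z x hx i
        obtain ⟨n, y, h⟩ := hx i
        refine ⟨n, z * y, ?_⟩
        calc _ = z • ((f i ^ n * x) • t i₀) := by
              simp only [← mul_smul, smul_eq_mul]; congr 1; ring
          _ = _ := by
            rw [h]
            simp only [← mul_smul]; congr 1; ring }
  -- The linear function f j ^ N t j is represented in I by x.
  have hx : ∀ j, ∃ x ∈ I, x • t i₀ = (c * f j ^ N) • t j := by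
    intro j
    have hmem : (c * f j ^ N) • t j ∈ Submodule.span A {t i₀} := by
      refine hloc _ _ fun i => ⟨N + N, Submodule.mem_span_singleton.2 ⟨a j i * a i i₀, ?_⟩⟩
      calc _ = a j i • (f i ^ N * c) • t i := by rw [hc', ← mul_smul]
        _ = (f i ^ N * c) • ((f j * f i) ^ N • t j) := by rw [ha, smul_comm]
        _ = _ := by
          simp only [← mul_smul, mul_pow, pow_add]; congr 1; ring
    obtain ⟨x, hx⟩ := Submodule.mem_span_singleton.1 hmem
    refine ⟨x, fun i => ⟨N, a j i, ?_⟩, hx⟩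
    calc _ = c • (f j * f i) ^ N • t j := by
          rw [mul_smul, hx]
          simp only [← mul_smul, mul_pow]; congr 1; ring
      _ = _ := by rw [ha, mul_smul]
  choose x hxI hx using hx
  have hx0 : ∀ j, x j ≠ 0 := fun j h0 => by
    have := hx j
    rw [h0, zero_smul, eq_comm, smul_eq_zero] at this
    exact this.elim (mul_ne_zero hc (pow_ne_zero _ (hf0 j))) (ht0 j)
  obtain ⟨a₀, ha₀I, ha₀, hgen⟩ := exists_generator_over_kernel hD I
    (fun h => hx0 i₀ (by simpa [h] using hxI i₀))
  -- The linear function represented by the generator a₀; divisibility by c is tested locally.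
  obtain ⟨e, he⟩ : ∃ e : B, c • e = a₀ • t i₀ := by
    have : a₀ • t i₀ ∈ LinearMap.range (LinearMap.lsmul A B c) := by
      refine hloc _ _ fun i => ?_
      obtain ⟨n, y, h⟩ := ha₀I i
      exact ⟨n, y • t i, by rw [LinearMap.lsmul_apply, ← mul_smul, ← h, mul_smul]⟩
    exact this
  have he0 : e ≠ 0 := fun h => by
    rw [h, smul_zero, eq_comm, smul_eq_zero] at he
    exact he.elim ha₀ (ht0 _)
  choose g q hg0 hDg hgq using fun j => hgen (x j) (hxI j)
  -- Over D(h) every f j ^ N t j is a multiple of e, so e serves as a coordinate there.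
  let h := ∏ j, g j
  have hh0 : h ≠ 0 := Finset.prod_ne_zero_iff.2 fun j _ => hg0 j
  have hDh : D h = 0 := by
    refine Finset.prod_induction g (fun z => D z = 0) (fun u v hu hv => by simp [hu, hv])
      D.map_one_eq_zero fun j _ => hDg j
  have hte : ∀ j, ∃ y : A, (h * f j ^ N) • t j = y • e := by
    intro j
    obtain ⟨r, hr⟩ : g j ∣ h := Finset.dvd_prod_of_mem g (Finset.mem_univ j)
    refine ⟨r * q j, smul_right_injective B hc ?_⟩
    calc c • (h * f j ^ N) • t j = r • g j • (c * f j ^ N) • t j := by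
          simp only [← mul_smul, hr]; congr 1; ring
      _ = r • (q j * a₀) • t i₀ := by rw [← hx, ← mul_smul (g j), hgq]
      _ = c • (r * q j) • e := by
          rw [mul_smul, ← he]
          simp only [← mul_smul]; congr 1; ring
  choose y hy using hte
  refine ⟨h, e, hDh, hh0, ?_, ?_⟩
  · obtain ⟨n, z, hz⟩ := ha₀I i₀
    have hz' : f i₀ ^ n • e = z • t i₀ := by
      apply smul_right_injective B hc
      change c • f i₀ ^ n • e = c • z • t i₀
      rw [smul_comm, he, ← mul_smul, hz, mul_smul]
    have hz0 : z ≠ 0 := by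
      rintro rfl
      rw [zero_smul, smul_eq_zero] at hz'
      exact hz'.elim (pow_ne_zero _ (hf0 _)) he0
    intro halg
    refine (ht i₀).transcendental ?_
    have h1 : IsAlgebraic A (z • t i₀) := hz' ▸ halg.smul _
    exact h1.of_smul (mem_nonZeroDivisors_of_ne_zero hz0)
  · intro b
    -- Over D(f i), b is a polynomial in t i, and inverting h and f i makes t i a multiple of e. The
    -- power of h is then made uniform in i, and the powers of f i are removed by `hloc`.
    have hall : ∀ i, ∃ m n : ℕ, f i ^ n • h ^ m • b ∈ Algebra.adjoin A {e} := by
      intro i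
      obtain ⟨n, p, hp⟩ := (ht i).exists_pow_smul_eq b
      refine ⟨p.natDegree, N * p.natDegree + n, ?_⟩
      have := smul_aeval_mem_adjoin (hy i) p
      rw [hp] at this
      convert this using 1
      simp only [← mul_smul]; congr 1; ring
    choose m n hmn using hall
    let M := Finset.univ.sup m
    have hmem : h ^ M • b ∈ Subalgebra.toSubmodule (Algebra.adjoin A {e}) := by
      refine hloc _ _ fun i => ⟨n i, ?_⟩
      have hle : m i ≤ M := Finset.le_sup (Finset.mem_univ i)
      have := Subalgebra.smul_mem _ (hmn i) (h ^ (M - m i))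
      rw [smul_comm, ← mul_smul (h ^ (M - m i)), ← pow_add, Nat.sub_add_cancel hle] at this
      exact this
    rw [Subalgebra.mem_toSubmodule, Algebra.adjoin_singleton_eq_range_aeval] at hmem
    obtain ⟨p, hp⟩ := hmem
    exact ⟨M, p, hp⟩

variable {k : Type*} [CommRing k] [Algebra k A] [Algebra k B] [IsScalarTower k A B]
  [Algebra.FiniteType k B] [CharZero A]

/-- A locally nilpotent derivation `∂` of the base of a line bundle lifts, after multiplication by
a nonzero element of its kernel, to the total space. -/
theorem exists_derivation_lift [Finite ι]
    (hf : Ideal.span (Set.range f) = ⊤) (ht : ∀ i, IsCoordinate (f i) (t i))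
    (htrans : ∀ i j, ∃ (n : ℕ) (a : A), (f i * f j) ^ n • t i = a • t j)
    {D : Derivation k A A} (hD : IsLND D) :
    ∃ (h : A) (D' : Derivation k B B), h ≠ 0 ∧ D h = 0 ∧ IsLND D' ∧
      ∀ a, D' (algebraMap A B a) = algebraMap A B (h * D a) := by
  obtain ⟨h, e, hDh, he⟩ := exists_isCoordinate_over_kernel hf ht htrans hD
  -- Here R = A[e], with D acting on the coefficients and killing e.
  obtain ⟨N, D', hD', H⟩ := exists_derivation_extension (k := k)
    ((aeval e : A[X] →ₐ[A] B).restrictScalars k) he.aeval_injective (coeffDerivation D)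
    hD.coeffDerivation (h := C h) (C_ne_zero.2 he.ne_zero) (by rw [coeffDerivation_C, hDh, C_0])
    (fun b => by
      obtain ⟨n, p, hp⟩ := he.exists_pow_smul_eq b
      exact ⟨n, p, by simpa [Algebra.smul_def] using hp⟩)
  refine ⟨h ^ N, D', pow_ne_zero _ he.ne_zero, by rw [Derivation.leibniz_pow, hDh]; simp, hD',
    fun a => ?_⟩
  have := H (C a)
  rw [coeffDerivation_C, ← C_pow, ← C_mul] at this
  simpa using this

/-- There is a locally nilpotent derivation of the total space of a line bundle whose kernel is the
ring of functions on the base. -/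
theorem exists_vertical_derivation
    (hf : Ideal.span (Set.range f) = ⊤) (ht : ∀ i, IsCoordinate (f i) (t i)) :
    ∃ D' : Derivation k B B, D' ≠ 0 ∧ IsLND D' ∧ (∀ a, D' (algebraMap A B a) = 0) ∧
      ∀ b, D' b = 0 → ∃ a, algebraMap A B a = b := by
  obtain ⟨i₀⟩ : Nonempty ι := by
    by_contra hne
    rw [not_nonempty_iff] at hne
    rw [Set.range_eq_empty, Ideal.span_empty] at hf
    exact bot_ne_top hf
  have h0 := (ht i₀).ne_zero
  have hinj := (ht i₀).aeval_injective
  have : FaithfulSMul A B :=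
    (faithfulSMul_iff_algebraMap_injective A B).2 (ht i₀).algebraMap_injective
  let δ : Derivation k A[X] A[X] := (derivative' (R := A)).restrictScalars k
  have hδ : ∀ p, δ p = derivative p := fun p => rfl
  have hδ' : IsLND δ := fun p => ⟨p.natDegree + 1, by
    have : ⇑δ = ⇑derivative := rfl
    rw [this]
    exact iterate_derivative_eq_zero (Nat.lt_succ_self _)⟩
  obtain ⟨N, D', hD', H⟩ := exists_derivation_extension (k := k)
    ((aeval (t i₀) : A[X] →ₐ[A] B).restrictScalars k) hinj δ
    hδ' (h := C (f i₀)) (C_ne_zero.2 h0) (by rw [hδ, derivative_C])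
    (fun b => by
      obtain ⟨n, p, hp⟩ := (ht i₀).exists_pow_smul_eq b
      exact ⟨n, p, by simpa [Algebra.smul_def] using hp⟩)
  have H' : ∀ p : A[X], D' (aeval (t i₀) p) = f i₀ ^ N • aeval (t i₀) (derivative p) := fun p => by
    have := H p
    rw [hδ, ← C_pow] at this
    simpa [Algebra.smul_def] using this
  have hDA : ∀ a, D' (algebraMap A B a) = 0 := fun a => by simpa using H' (C a)
  refine ⟨D', ?_, hD', hDA, ?_⟩
  · rintro rfl
    have := H' X
    rw [derivative_X, map_one, Derivation.zero_apply, eq_comm, smul_eq_zero] at this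
    exact this.elim (pow_ne_zero _ h0) one_ne_zero
  · intro b hb
    obtain ⟨n, p, hp⟩ := (ht i₀).exists_pow_smul_eq b
    have hD0 : D' (f i₀ ^ n • b) = 0 := by
      rw [Algebra.smul_def, Derivation.leibniz, hb, hDA]; simp
    rw [← hp, H', smul_eq_zero] at hD0
    have hp' : derivative p = 0 :=
      (map_eq_zero_iff _ hinj).1 (hD0.resolve_left (pow_ne_zero _ h0))
    obtain ⟨a, rfl⟩ : ∃ a, p = C a := ⟨_, eq_C_of_derivative_eq_zero hp'⟩
    have hb' : algebraMap A B a = f i₀ ^ n • b := by simpa using hp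
    -- So far b is only a fraction a / f i₀ ^ n. In the chart i it is a polynomial in t i up to a
    -- power of f i, and being such a fraction makes that polynomial constant; the local memberships
    -- in A are then glued.
    have : b ∈ LinearMap.range (Algebra.linearMap A B) := by
      refine Submodule.mem_of_span_eq_top_of_smul_pow_mem _ _ hf b ?_
      rintro ⟨_, i, rfl⟩
      obtain ⟨m, P, hP⟩ := (ht i).exists_pow_smul_eq b
      refine ⟨m, P.coeff 0, ?_⟩
      have h1 : C (f i₀ ^ n) * P = C (f i ^ m * a) := by
        apply (ht i).aeval_injective
        rw [map_mul, hP, aeval_C, aeval_C, map_mul, hb', ← Algebra.smul_def, ← Algebra.smul_def,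
          smul_comm]
      have h2 : P = C (P.coeff 0) := by
        ext l
        have := congrArg (fun Q => coeff Q l) h1
        simp only [coeff_C_mul, coeff_C] at this ⊢
        split_ifs at this ⊢ with hl
        · rw [hl]
        · exact (mul_eq_zero.1 this).resolve_left (pow_ne_zero _ h0)
      change algebraMap A B (P.coeff 0) = f i ^ m • b
      rw [← hP]
      nth_rw 2 [h2]
      rw [aeval_C]
    exact this

end Coordinates

/-! ### The exponential of a locally nilpotent derivation -/

section Exponential

variable {k A : Type*} [Field k] [CharZero k] [CommRing A] [Algebra k A] {D : Derivation k A A}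

/-- The polynomial `∑ Dⁿ(a) Xⁿ / n!`. -/
noncomputable def expPolyFun (hD : IsLND D) (a : A) : A[X] :=
  ∑ n ∈ Finset.range (hD a).choose, monomial n ((n.factorial : k)⁻¹ • D^[n] a)

omit [CharZero k] in
theorem coeff_expPolyFun (hD : IsLND D) (a : A) (n : ℕ) :
    (expPolyFun hD a).coeff n = (n.factorial : k)⁻¹ • D^[n] a := by
  simp only [expPolyFun, finsetSum_coeff, coeff_monomial, Finset.sum_ite_eq', Finset.mem_range]
  split_ifs with h
  · rfl
  · rw [iterate_derivation_eq_zero_of_le D (not_lt.1 h) (hD a).choose_spec, smul_zero]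

/-- The ring homomorphism `exp(X D) : A → A[X]`. -/
noncomputable def expPoly (hD : IsLND D) : A →+* A[X] where
  toFun := expPolyFun hD
  map_one' := by
    ext n
    rw [coeff_expPolyFun, coeff_one]
    rcases n with _ | n
    · simp
    · rw [Function.iterate_succ_apply, D.map_one_eq_zero, iterate_derivation_zero]; simp
  map_zero' := by
    ext n
    rw [coeff_expPolyFun, iterate_derivation_zero]; simp
  map_add' a b := by
    ext n
    simp only [coeff_expPolyFun, coeff_add, iterate_derivation_add, smul_add]
  map_mul' a b := by
    ext n
    simp only [coeff_expPolyFun, coeff_mul, iterate_derivation_mul, Finset.smul_sum]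
    refine Finset.sum_congr rfl fun ij hij => ?_
    have hij : ij.1 + ij.2 = n := Finset.HasAntidiagonal.mem_antidiagonal.1 hij
    have h0 := fun n : ℕ => Nat.cast_ne_zero (R := k).2 n.factorial_ne_zero
    have hch : ((ij.1 + ij.2).choose ij.1 : k) * ij.1.factorial * ij.2.factorial =
        (ij.1 + ij.2).factorial := by
      rw [Nat.choose_symm_add]
      exact_mod_cast Nat.add_choose_mul_factorial_mul_factorial ij.1 ij.2
    rw [smul_mul_smul_comm, ← Nat.cast_smul_eq_nsmul k, smul_smul, ← hij]
    congr 1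
    have := h0 ij.1
    have := h0 ij.2
    have := h0 (ij.1 + ij.2)
    field_simp
    rw [← hch]

theorem coeff_expPoly (hD : IsLND D) (a : A) (n : ℕ) :
    (expPoly hD a).coeff n = (n.factorial : k)⁻¹ • D^[n] a :=
  coeff_expPolyFun hD a n

theorem coeff_zero_expPoly (hD : IsLND D) (a : A) : (expPoly hD a).coeff 0 = a := by
  simp [coeff_expPoly]

theorem coeff_one_expPoly (hD : IsLND D) (a : A) : (expPoly hD a).coeff 1 = D a := by
  simp [coeff_expPoly]

theorem expPoly_of_eq_zero (hD : IsLND D) {a : A} (ha : D a = 0) : expPoly hD a = C a := by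
  ext n
  rw [coeff_expPoly, coeff_C]
  rcases n with _ | n
  · simp
  · rw [Function.iterate_succ_apply, ha, iterate_derivation_zero]; simp

/-- Both sides have coefficients D^(m+n)(a) / (m! n!). This is the group law exp((X + Y)D) = exp(XD)
exp(YD), read off at Y ^ n. -/
theorem hasseDeriv_expPoly (hD : IsLND D) (a : A) (n : ℕ) :
    hasseDeriv n (expPoly hD a) = expPoly hD ((expPoly hD a).coeff n) := by
  ext m
  rw [hasseDeriv_coeff, coeff_expPoly, coeff_expPoly, coeff_expPoly]
  have hsm : ∀ (m : ℕ) (c : k) (a : A), D^[m] (c • a) = c • D^[m] a := by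
    intro m
    induction m with
    | zero => intros; rfl
    | succ m ih => intro c a; simp only [Function.iterate_succ_apply, Derivation.map_smul, ih]
  have h0 := fun n : ℕ => Nat.cast_ne_zero (R := k).2 n.factorial_ne_zero
  have hch : ((n + m).choose n : k) * n.factorial * m.factorial =
        (n + m).factorial := by
    rw [Nat.choose_symm_add]
    exact_mod_cast Nat.add_choose_mul_factorial_mul_factorial n m
  rw [hsm, ← Function.iterate_add_apply, smul_smul, ← nsmul_eq_mul, ← Nat.cast_smul_eq_nsmul k,
    smul_smul, add_comm m n]
  congr 1
  have := h0 n
  have := h0 m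
  have := h0 (n + m)
  field_simp
  rw [← hch]; ring

/-- Taylor expansion at d: its coefficients are Hasse derivatives, which `hasseDeriv_expPoly` turns
back into exponentials. -/
theorem eval₂_expPoly_add (hD : IsLND D) {R : Type*} [CommRing R] (x : A →+* R) (c d : R) (a : A) :
    eval₂ x (c + d) (expPoly hD a) =
      eval₂ ((eval₂RingHom x d).comp (expPoly hD)) c (expPoly hD a) := by
  rw [eval₂_eq_eval_map, ← taylor_eval, eval₂_eq_eval_map]
  congr 1
  ext n
  rw [taylor_coeff, coeff_map, RingHom.comp_apply, ← hasseDeriv_expPoly, coe_eval₂RingHom,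
    eval₂_eq_eval_map]
  congr 1
  ext m
  simp [hasseDeriv_coeff]

/-- A coaction of the additive group on `A` is the exponential of a locally nilpotent derivation. -/
theorem exists_eq_expPoly (ψ : A →+* A[X])
    (hk : ∀ c : k, ψ (algebraMap k A c) = C (algebraMap k A c))
    (h0 : ∀ a, (ψ a).coeff 0 = a)
    (hadd : ∀ a, eval₂ (C.comp C) (X + C X) (ψ a) =
      eval₂ ((eval₂RingHom ((C : A[X] →+* A[X][X]).comp C) (C X)).comp ψ) X (ψ a)) :
    ∃ (D : Derivation k A A) (hD : IsLND D), ∀ a, ψ a = expPoly hD a := by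
  let D : Derivation k A A := Derivation.mk'
    { toFun := fun a => (ψ a).coeff 1
      map_add' := by simp
      map_smul' := fun c a => by
        rw [Algebra.smul_def, map_mul, hk, coeff_C_mul, RingHom.id_apply, Algebra.smul_def] }
    (fun a b => by
      simp only [LinearMap.coe_mk, AddHom.coe_mk, map_mul, mul_coeff_one, h0, smul_eq_mul]
      ring)
  have hD1 : ∀ a, D a = (ψ a).coeff 1 := fun a => rfl
  -- The linear coefficient in the outer variable of the group law is the differential equation
  -- ψ(a)' = ψ(D a), whose solution is the exponential.
  have hder : ∀ a, derivative (ψ a) = ψ (D a) := by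
    intro a
    have e1 : eval₂ (C.comp C) (X + C X) (ψ a) = taylor X ((ψ a).map C) := by
      rw [taylor_apply, comp, eval₂_map]
    have e2 : eval₂RingHom ((C : A[X] →+* A[X][X]).comp C) (C X) = C := by
      ext <;> simp
    have := congrArg (fun p => coeff p 1) (hadd a)
    simp only [e1, e2, taylor_coeff_one] at this
    rw [derivative_map, Polynomial.eval_map, eval₂_C_X] at this
    have e3 : eval₂ ((C : A[X] →+* A[X][X]).comp ψ) X (ψ a) = (ψ a).map ψ := by
      rw [← eval₂_map, eval₂_C_X]
    rw [this, e3, coeff_map, hD1]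
  have hcoeff : ∀ (n : ℕ) (a : A), (n.factorial : k) • (ψ a).coeff n = D^[n] a := by
    intro n
    induction n with
    | zero => intro a; simp [h0]
    | succ n ih =>
      intro a
      rw [Function.iterate_succ_apply, ← ih, ← hder, coeff_derivative, Nat.factorial_succ,
        mul_comm, Nat.cast_mul, mul_smul, mul_comm (coeff _ _), ← Nat.cast_succ,
        Nat.cast_smul_eq_nsmul k (n + 1), nsmul_eq_mul]
  have hD : IsLND D := fun a => ⟨(ψ a).natDegree + 1, by
    rw [← hcoeff, coeff_eq_zero_of_natDegree_lt (Nat.lt_succ_self _), smul_zero]⟩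
  refine ⟨D, hD, fun a => ?_⟩
  ext n
  rw [coeff_expPoly, ← hcoeff, inv_smul_smul₀ (Nat.cast_ne_zero.2 n.factorial_ne_zero)]

end Exponential

/-! ### Actions of the additive group and locally nilpotent derivations -/

section Points

variable {X T T' : Scheme.{0}}

theorem comp_linePoint (f : T' ⟶ T) (c : Γ(T, ⊤)) (x : T ⟶ X) :
    f ≫ linePoint c x = linePoint (f.appTop c) (f ≫ x) :=
  AffineSpace.comp_homOfVector _ _ _

theorem linePoint_over (c : Γ(T, ⊤)) (x : T ⟶ X) : linePoint c x ≫ (𝔸(PUnit; X) ↘ X) = x :=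
  AffineSpace.homOfVector_over _ _

theorem linePoint_coord (c : Γ(T, ⊤)) (x : T ⟶ X) :
    (linePoint c x).appTop (AffineSpace.coord X PUnit.unit) = c :=
  AffineSpace.homOfVector_appTop_coord _ _ _

variable [IsAffine X]

/-- The morphism to an affine scheme determined by a homomorphism of rings of functions. -/
noncomputable def homOfAppTop (α : Γ(X, ⊤) →+* Γ(T, ⊤)) : T ⟶ X :=
  T.toSpecΓ ≫ Spec.map (CommRingCat.ofHom α) ≫ X.isoSpec.inv

theorem homOfAppTop_appTop (α : Γ(X, ⊤) →+* Γ(T, ⊤)) (a : Γ(X, ⊤)) :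
    (homOfAppTop α).appTop a = α a := by
  have : (homOfAppTop α).appTop = CommRingCat.ofHom α := by
    have h : homOfAppTop α ≫ X.toSpecΓ = T.toSpecΓ ≫ Spec.map (CommRingCat.ofHom α) := by
      simp only [homOfAppTop, Category.assoc, Scheme.isoSpec_inv_toSpecΓ]
      exact congrArg (T.toSpecΓ ≫ ·) (Category.comp_id _)
    have h' := congrArg Scheme.Hom.appTop h
    rw [Scheme.Hom.comp_appTop, Scheme.Hom.comp_appTop, Scheme.toSpecΓ_appTop,
      Scheme.toSpecΓ_appTop, Scheme.ΓSpecIso_naturality] at h'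
    exact (cancel_epi _).1 h'
  rw [this]; rfl

theorem hom_ext_of_appTop {f g : T ⟶ X} (h : ∀ a, f.appTop a = g.appTop a) : f = g :=
  ext_of_isAffine (CommRingCat.hom_ext (RingHom.ext h))

end Points

section Actions

variable {X : Scheme.{0}} [X.Over SpecC]

theorem appTop_over_eq_algebraMap (z : Γ(SpecC, ⊤)) :
    (X ↘ SpecC).appTop z =
      algebraMap ℂ Γ(X, ⊤) ((Scheme.ΓSpecIso (CommRingCat.of ℂ)).hom z) := by
  change _ = (X ↘ SpecC).appTop ((Scheme.ΓSpecIso (CommRingCat.of ℂ)).inv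
    ((Scheme.ΓSpecIso (CommRingCat.of ℂ)).hom z))
  rw [Iso.hom_inv_id_apply]

theorem algebraMap_eq_appTop_over (c : ℂ) :
    algebraMap ℂ Γ(X, ⊤) c = (X ↘ SpecC).appTop ((Scheme.ΓSpecIso (CommRingCat.of ℂ)).inv c) :=
  rfl

variable [IsAffine X]

/-- The morphism `ℂ × X ⟶ X` given by the exponential of a locally nilpotent derivation. -/
noncomputable def expHom {D : Derivation ℂ Γ(X, ⊤) Γ(X, ⊤)} (hD : IsLND D) : 𝔸(PUnit; X) ⟶ X :=
  homOfAppTop ((eval₂RingHom (𝔸(PUnit; X) ↘ X).appTop.hom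
    (AffineSpace.coord X PUnit.unit)).comp (expPoly hD))

theorem linePoint_expHom_appTop {D : Derivation ℂ Γ(X, ⊤) Γ(X, ⊤)} (hD : IsLND D) {T : Scheme.{0}}
    (c : Γ(T, ⊤)) (x : T ⟶ X) (a : Γ(X, ⊤)) :
    (linePoint c x ≫ expHom hD).appTop a = eval₂ x.appTop.hom c (expPoly hD a) := by
  rw [Scheme.Hom.comp_appTop, CommRingCat.comp_apply, expHom, homOfAppTop_appTop,
    RingHom.comp_apply, coe_eval₂RingHom]
  change (linePoint c x).appTop.hom _ = _
  rw [hom_eval₂]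
  congr 1
  · rw [← CommRingCat.hom_comp, ← Scheme.Hom.comp_appTop, linePoint_over]
  · exact linePoint_coord c x

/-- The action of the additive group obtained by integrating a locally nilpotent derivation. -/
noncomputable def expAction {D : Derivation ℂ Γ(X, ⊤) Γ(X, ⊤)} (hD : IsLND D) : GaAction X where
  hom := expHom hD
  hom_over := by
    refine hom_ext_of_appTop fun z => ?_
    rw [Scheme.Hom.comp_appTop, Scheme.Hom.comp_appTop, CommRingCat.comp_apply,
      CommRingCat.comp_apply, expHom, homOfAppTop_appTop, appTop_over_eq_algebraMap,
      RingHom.comp_apply, expPoly_of_eq_zero hD (D.map_algebraMap _), coe_eval₂RingHom, eval₂_C]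
  zero_act T x := by
    refine hom_ext_of_appTop fun a => ?_
    rw [linePoint_expHom_appTop, eval₂_at_zero, coeff_zero_expPoly]
  add_act T c d x := by
    refine hom_ext_of_appTop fun a => ?_
    rw [linePoint_expHom_appTop, linePoint_expHom_appTop, eval₂_expPoly_add]
    congr 1
    ext a
    exact (linePoint_expHom_appTop hD d x a).symm

/-- Every action of the additive group on an affine variety is the exponential of a locally
nilpotent derivation. -/
theorem GaAction.exists_expPoly (φ : GaAction X) :
    ∃ (D : Derivation ℂ Γ(X, ⊤) Γ(X, ⊤)) (hD : IsLND D), ∀ (T : Scheme.{0}) (c : Γ(T, ⊤))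
      (x : T ⟶ X) (a : Γ(X, ⊤)),
      (linePoint c x ≫ φ.hom).appTop a = eval₂ x.appTop.hom c (expPoly hD a) := by
  -- The universal pair of a time and a point of X: every (c, x) over T is pulled back from (X, x₀)
  -- over S, so ψ determines the action on all points.
  let S : Scheme.{0} := Spec (CommRingCat.of Γ(X, ⊤)[X])
  let i : Γ(X, ⊤)[X] →+* Γ(S, ⊤) := (Scheme.ΓSpecIso (CommRingCat.of Γ(X, ⊤)[X])).inv.hom
  let i' : Γ(S, ⊤) →+* Γ(X, ⊤)[X] := (Scheme.ΓSpecIso (CommRingCat.of Γ(X, ⊤)[X])).hom.hom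
  have hi'i : ∀ p, i' (i p) = p := fun p =>
    Iso.inv_hom_id_apply (Scheme.ΓSpecIso (CommRingCat.of Γ(X, ⊤)[X])) p
  have hii' : ∀ p, i (i' p) = p := fun p =>
    Iso.hom_inv_id_apply (Scheme.ΓSpecIso (CommRingCat.of Γ(X, ⊤)[X])) p
  let x₀ : S ⟶ X := homOfAppTop (i.comp C)
  have hx₀ : ∀ a, x₀.appTop a = i (C a) := fun a => homOfAppTop_appTop (i.comp C) a
  let ψ : Γ(X, ⊤) →+* Γ(X, ⊤)[X] := i'.comp (linePoint (i Polynomial.X) x₀ ≫ φ.hom).appTop.hom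
  have hψ : ∀ (T : Scheme.{0}) (c : Γ(T, ⊤)) (x : T ⟶ X) (a : Γ(X, ⊤)),
      (linePoint c x ≫ φ.hom).appTop a = eval₂ x.appTop.hom c (ψ a) := by
    intro T c x a
    let f : T ⟶ S := homOfAppTop ((eval₂RingHom x.appTop.hom c).comp i')
    have hf : ∀ p, f.appTop (i p) = eval₂ x.appTop.hom c p := fun p => by
      rw [homOfAppTop_appTop, RingHom.comp_apply, hi'i, coe_eval₂RingHom]
    have hx : f ≫ x₀ = x := hom_ext_of_appTop fun a => by
      rw [Scheme.Hom.comp_appTop, CommRingCat.comp_apply, hx₀, hf, eval₂_C]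
    have hc : f.appTop (i Polynomial.X) = c := by rw [hf, eval₂_X]
    rw [← hf]
    change _ = f.appTop (i (i' _))
    rw [hii']
    change _ = f.appTop ((linePoint (i Polynomial.X) x₀ ≫ φ.hom).appTop a)
    rw [← CommRingCat.comp_apply, ← Scheme.Hom.comp_appTop, ← Category.assoc, comp_linePoint, hx, hc]
  have h0 : ∀ a, (ψ a).coeff 0 = a := fun a => by
    have := hψ X 0 (𝟙 X) a
    rw [φ.zero_act, eval₂_at_zero] at this
    exact this.symm
  have hk : ∀ c : ℂ, ψ (algebraMap ℂ Γ(X, ⊤) c) = C (algebraMap ℂ Γ(X, ⊤) c) := by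
    intro c
    change i' ((linePoint (i Polynomial.X) x₀ ≫ φ.hom).appTop _) = _
    have e : (linePoint (i Polynomial.X) x₀ ≫ φ.hom) ≫ (X ↘ SpecC) = x₀ ≫ (X ↘ SpecC) := by
      rw [Category.assoc, φ.hom_over, ← Category.assoc, linePoint_over]
    rw [algebraMap_eq_appTop_over]
    refine (congrArg (fun g : S ⟶ SpecC => i' (g.appTop
      ((Scheme.ΓSpecIso (CommRingCat.of ℂ)).inv c))) e).trans ?_
    exact (congrArg i' (hx₀ _)).trans (hi'i _)
  have hadd : ∀ a, eval₂ (C.comp C) (Polynomial.X + C Polynomial.X) (ψ a) =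
      eval₂ ((eval₂RingHom ((C : Γ(X, ⊤)[X] →+* Γ(X, ⊤)[X][X]).comp C) (C Polynomial.X)).comp ψ)
        Polynomial.X (ψ a) := by
    intro a
    -- The universal point together with two independent times, where the group law becomes an
    -- identity of polynomials.
    let S₂ : Scheme.{0} := Spec (CommRingCat.of Γ(X, ⊤)[X][X])
    let i₂ : Γ(X, ⊤)[X][X] →+* Γ(S₂, ⊤) :=
      (Scheme.ΓSpecIso (CommRingCat.of Γ(X, ⊤)[X][X])).inv.hom
    have hi₂ : Function.Injective i₂ := Function.LeftInverse.injective
      (g := (Scheme.ΓSpecIso (CommRingCat.of Γ(X, ⊤)[X][X])).hom)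
      fun p => Iso.inv_hom_id_apply (Scheme.ΓSpecIso (CommRingCat.of Γ(X, ⊤)[X][X])) p
    let x : S₂ ⟶ X := homOfAppTop (i₂.comp (C.comp C))
    have hx : x.appTop.hom = i₂.comp (C.comp C) := RingHom.ext fun a => homOfAppTop_appTop _ a
    have := congrArg (fun f : S₂ ⟶ X => f.appTop a)
      (φ.add_act S₂ (i₂ Polynomial.X) (i₂ (C Polynomial.X)) x)
    simp only [hψ] at this
    apply hi₂
    rw [hom_eval₂, hom_eval₂, ← hx, map_add, this]
    congr 1
    ext b
    rw [RingHom.comp_apply, RingHom.comp_apply, coe_eval₂RingHom, hom_eval₂, ← hx]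
    exact hψ S₂ _ _ b
  obtain ⟨D, hD, h⟩ := exists_eq_expPoly ψ hk h0 hadd
  exact ⟨D, hD, fun T c x a => by rw [hψ, h]⟩

theorem expAction_nontrivial {D : Derivation ℂ Γ(X, ⊤) Γ(X, ⊤)} (hD : IsLND D) (h : D ≠ 0) :
    (expAction hD).Nontrivial := by
  intro htriv
  refine h (Derivation.ext fun a => ?_)
  let S : Scheme.{0} := Spec (CommRingCat.of Γ(X, ⊤)[X])
  let i : Γ(X, ⊤)[X] →+* Γ(S, ⊤) := (Scheme.ΓSpecIso (CommRingCat.of Γ(X, ⊤)[X])).inv.hom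
  have hi : Function.Injective i := Function.LeftInverse.injective
    (g := (Scheme.ΓSpecIso (CommRingCat.of Γ(X, ⊤)[X])).hom)
    fun p => Iso.inv_hom_id_apply (Scheme.ΓSpecIso (CommRingCat.of Γ(X, ⊤)[X])) p
  let x : S ⟶ X := homOfAppTop (i.comp C)
  have hx : x.appTop.hom = i.comp C := RingHom.ext fun a => homOfAppTop_appTop _ a
  have e := linePoint_expHom_appTop hD (i Polynomial.X) x a
  change expHom hD = _ at htriv
  -- At the universal point triviality says exp(XD)(a) = a; the coefficient of X is D a.
  rw [htriv, linePoint_over, hx, ← hom_eval₂, eval₂_C_X] at e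
  have e' : i (C a) = i (expPoly hD a) := by rw [← e]; exact (homOfAppTop_appTop (i.comp C) a).symm
  rw [Derivation.zero_apply, ← coeff_one_expPoly hD, ← hi e', coeff_C]
  simp

end Actions

/-! ### Coordinates on the total space of a line bundle -/

/-- A coordinate of `E` over `C` gives one of `B` over `D(f)`, if `A ⊆ C ⊆ A[1/f]` and
`B ⊆ E ⊆ B[1/f]`. -/
theorem isCoordinate_of_bijective {A B C E : Type*} [CommRing A] [CommRing B] [CommRing C]
    [CommRing E] [Algebra A B] [Algebra A C] [Algebra B E] [Algebra C E] [Algebra A E]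
    [IsScalarTower A B E] [IsScalarTower A C E] [IsDomain A]
    (hAC : Function.Injective (algebraMap A C)) (hBE : Function.Injective (algebraMap B E))
    {f : A} (hf : f ≠ 0) (hC : ∀ c : C, ∃ (n : ℕ) (a : A), algebraMap A C a = f ^ n • c)
    {t : E} (ht : Function.Bijective (aeval t : C[X] →ₐ[C] E)) {b : B} {m : ℕ}
    (hb : algebraMap B E b = f ^ m • t) : IsCoordinate f b := by
  refine ⟨hf, ?_, fun x => ?_⟩
  · have h1 : Transcendental C t := transcendental_iff_injective.2 ht.1
    have h2 : Transcendental A t := fun h => h1 (h.extendScalars hAC)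
    intro hb'
    have h3 : IsAlgebraic A (f ^ m • t) := by
      rw [← hb]
      exact hb'.algebraMap
    exact h2 (h3.of_smul (mem_nonZeroDivisors_of_ne_zero (pow_ne_zero _ hf)))
  · have hpoly : ∀ Q : C[X], ∃ (n : ℕ) (P : A[X]), P.map (algebraMap A C) = f ^ n • Q := by
      intro Q
      induction Q using Polynomial.induction_on' with
      | add p q hp hq =>
        obtain ⟨n, P, hP⟩ := hp
        obtain ⟨n', P', hP'⟩ := hq
        refine ⟨n + n', f ^ n' • P + f ^ n • P', ?_⟩
        have hsm : ∀ (a : A) (P : A[X]), (a • P).map (algebraMap A C) =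
            a • P.map (algebraMap A C) := fun a P => by
          rw [Polynomial.map_smul, algebraMap_smul]
        rw [Polynomial.map_add, hsm, hsm, hP, hP', smul_add, smul_smul, smul_smul, ← pow_add,
          ← pow_add, add_comm n']
      | monomial i c =>
        obtain ⟨n, a, ha⟩ := hC c
        exact ⟨n, monomial i a, by rw [map_monomial, ha, smul_monomial]⟩
    obtain ⟨Q, hQ⟩ := ht.2 (algebraMap B E x)
    obtain ⟨n, P, hP⟩ := hpoly Q
    have hPt : aeval t P = f ^ n • algebraMap B E x := by
      rw [← hQ, ← aeval_map_algebraMap C, hP, ← algebraMap_smul C, map_smul, algebraMap_smul]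
    have hmem := smul_aeval_mem_adjoin (u := f ^ m) (y := 1) (t := t) (e := algebraMap B E b)
      (by rw [hb, one_smul]) P
    rw [Algebra.adjoin_singleton_eq_range_aeval] at hmem
    obtain ⟨P', hP'⟩ := hmem
    refine ⟨m * P.natDegree + n, P', hBE ?_⟩
    rw [← aeval_algebraMap_apply]
    refine hP'.trans ?_
    rw [hPt, Algebra.algebraMap_eq_smul_one (f ^ _ • x), smul_assoc,
      ← Algebra.algebraMap_eq_smul_one, ← pow_mul, smul_smul, ← pow_add]

/-! ### Restriction of functions and extension from basic open sets -/

section Restriction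

variable {X : Scheme.{0}}

/-- Restriction of functions to a smaller open set. -/
noncomputable abbrev res {U V : X.Opens} (h : U ≤ V) : Γ(X, V) →+* Γ(X, U) :=
  (X.presheaf.map (homOfLE h).op).hom

theorem res_res {U V W : X.Opens} (h : U ≤ V) (h' : V ≤ W) (a : Γ(X, W)) :
    res h (res h' a) = res (h.trans h') a := by
  rw [← RingHom.comp_apply, ← CommRingCat.hom_comp, ← Functor.map_comp]
  rfl

theorem res_injective [IsIntegral X] {U V : X.Opens} (h : U ≤ V) (hU : U ≠ ⊥) :
    Function.Injective (res h) := by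
  have : Nonempty U := by
    rw [← not_isEmpty_iff]
    intro he
    exact hU (TopologicalSpace.Opens.ext (Set.isEmpty_coe_sort.1 he))
  exact map_injective_of_isIntegral X (homOfLE h)

theorem presheaf_map_loop {U V W : (X.Opens)ᵒᵖ} (i : U ⟶ V) (j : V ⟶ W) (k : W ⟶ U)
    (a : X.presheaf.obj U) : X.presheaf.map k (X.presheaf.map j (X.presheaf.map i a)) = a := by
  rw [← CommRingCat.comp_apply, ← CommRingCat.comp_apply, ← Functor.map_comp, ← Functor.map_comp,
    Subsingleton.elim (i ≫ j ≫ k) (𝟙 U), CategoryTheory.Functor.map_id]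
  rfl

theorem app_res {L : Scheme.{0}} (π : L ⟶ X) {U V : X.Opens} (h : U ≤ V) (a : Γ(X, V)) :
    π.app U (res h a) = res (π.preimage_mono h) (π.app V a) := by
  have := ConcreteCategory.congr_hom (π.naturality (homOfLE h).op) a
  exact this

/-- Functions on an open set containing `D(f)` extend to the whole of an affine variety after
multiplication by a power of `f`. -/
theorem exists_res_eq_pow_mul [IsIntegral X] [IsAffine X] {f : Γ(X, ⊤)} (hf : f ≠ 0)
    {U : X.Opens} (hU : X.basicOpen f ≤ U) (s : Γ(X, U)) :
    ∃ (n : ℕ) (a : Γ(X, ⊤)), res le_top a = res le_top f ^ n * s := by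
  obtain ⟨n, a, h⟩ := IsLocalization.Away.surj f (res hU s)
  refine ⟨n, a, res_injective hU (by rwa [Ne, basicOpen_eq_bot_iff]) ?_⟩
  rw [map_mul, map_pow, res_res, res_res, mul_comm]
  exact h.symm

end Restriction

/-! ### Local trivializations as polynomial rings -/

section Trivialization

variable {X L : Scheme.{0}} (π : L ⟶ X)

/-- Since U is affine, 𝒪(U × ℂ) is 𝒪(U)[T], and under this identification the pullback along (π, t)
is evaluation at T = t. -/
theorem bijective_of_isIso_localTriv {U : X.Opens} (hU : IsAffineOpen U) (t : Γ(L, π ⁻¹ᵁ U))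
    (ht : IsIso (localTriv π U t)) :
    Function.Bijective (eval₂RingHom (π.app U).hom t) := by
  have : IsAffine U.toScheme := hU
  have h1 : Function.Bijective (MvPolynomial.eval₂Hom
      ((𝔸(PUnit; U.toScheme) ↘ U.toScheme).appTop).hom
      (AffineSpace.coord U.toScheme)) := by
    have e := AffineSpace.isoOfIsAffine_hom_appTop (n := PUnit) (S := U.toScheme)
    have hiso : IsIso (CommRingCat.ofHom
        (MvPolynomial.eval₂Hom ((𝔸(PUnit; U.toScheme) ↘ U.toScheme).appTop).hom
          (AffineSpace.coord U.toScheme))) := by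
      have : IsIso ((Scheme.ΓSpecIso _).hom ≫ CommRingCat.ofHom
        (MvPolynomial.eval₂Hom ((𝔸(PUnit; U.toScheme) ↘ U.toScheme).appTop).hom
          (AffineSpace.coord U.toScheme))) := by
        rw [← e]; exact inferInstanceAs (IsIso (Scheme.Hom.app _ ⊤))
      exact IsIso.of_isIso_comp_left (Scheme.ΓSpecIso _).hom _
    exact ConcreteCategory.bijective_of_isIso (CommRingCat.ofHom
      (MvPolynomial.eval₂Hom ((𝔸(PUnit; U.toScheme) ↘ U.toScheme).appTop).hom
        (AffineSpace.coord U.toScheme)))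
  have : IsIso (localTriv π U t).appTop := inferInstanceAs (IsIso (Scheme.Hom.app _ ⊤))
  have h2 : Function.Bijective (localTriv π U t).appTop :=
    ConcreteCategory.bijective_of_isIso (localTriv π U t).appTop
  have h3 : Function.Bijective (π ⁻¹ᵁ U).topIso.hom :=
    ConcreteCategory.bijective_of_isIso (π ⁻¹ᵁ U).topIso.hom
  have h4 : Function.Bijective (Polynomial.mapEquiv U.topIso.symm.commRingCatIsoToRingEquiv) :=
    RingEquiv.bijective _
  have h5 := (MvPolynomial.uniqueAlgEquiv Γ(U.toScheme, ⊤) PUnit).symm.bijective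
  have key : ⇑(eval₂RingHom (π.app U).hom t) = (π ⁻¹ᵁ U).topIso.hom ∘ (localTriv π U t).appTop ∘
      (MvPolynomial.eval₂Hom ((𝔸(PUnit; U.toScheme) ↘ U.toScheme).appTop).hom
      (AffineSpace.coord U.toScheme)) ∘ (MvPolynomial.uniqueAlgEquiv Γ(U.toScheme, ⊤) PUnit).symm ∘
      (Polynomial.mapEquiv U.topIso.symm.commRingCatIsoToRingEquiv) := by
    have hres : ∀ a, (π ⁻¹ᵁ U).topIso.hom ((localTriv π U t).appTop
        ((𝔸(PUnit; U.toScheme) ↘ U.toScheme).appTop (U.topIso.inv a))) = π.app U a := by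
      intro a
      rw [← CommRingCat.comp_apply _ (localTriv π U t).appTop, ← Scheme.Hom.comp_appTop, localTriv,
        linePoint_over, morphismRestrict_appTop]
      have hnat := ConcreteCategory.congr_hom (π.naturality (eqToHom U.ι_image_top).op) a
      change L.presheaf.map _ (L.presheaf.map _ (π.app _ (X.presheaf.map _ a))) = _
      refine (congrArg (fun z => L.presheaf.map _ (L.presheaf.map _ z)) hnat).trans ?_
      exact presheaf_map_loop _ _ _ (π.app U a)
    have ht' : (π ⁻¹ᵁ U).topIso.hom ((localTriv π U t).appTop
        (AffineSpace.coord U.toScheme PUnit.unit)) = t := by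
      rw [localTriv, linePoint_coord]
      exact Iso.inv_hom_id_apply (π ⁻¹ᵁ U).topIso t
    funext p
    induction p using Polynomial.induction_on' with
    | add p q hp hq =>
      simp only [map_add, hp, hq, Function.comp_apply]
    | monomial n a =>
      simp only [Function.comp_apply, mapEquiv_apply, map_monomial, MvPolynomial.coe_eval₂Hom,
        MvPolynomial.eval₂_uniqueAlgEquiv_symm, eval₂_monomial, coe_eval₂RingHom, map_mul, map_pow]
      exact (congrArg₂ (fun u v => u * v ^ n) (hres a) ht').symm
  rw [key]
  exact h3.comp (h2.comp (h1.comp (h5.comp h4)))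

/-- The algebra structure on `𝒪(L)` over `𝒪(X)` given by a morphism `L ⟶ X`. -/
noncomputable abbrev sectionsAlgebraOfHom : Algebra Γ(X, ⊤) Γ(L, ⊤) := π.appTop.hom.toAlgebra

end Trivialization

/-- The functions on the total space of a line bundle admit coordinates over a cover of the base by
basic open sets. -/
theorem IsLineBundle.exists_isCoordinate {L X : Scheme.{0}} [L.Over SpecC] [X.Over SpecC]
    [IsAffineVariety L] [IsAffineVariety X] {π : L ⟶ X} (hπ : IsLineBundle π) :
    let _ := sectionsAlgebraOfHom π
    ∃ (ι : Type) (_ : Finite ι) (f : ι → Γ(X, ⊤)) (t : ι → Γ(L, ⊤)),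
      Ideal.span (Set.range f) = ⊤ ∧ (∀ i, IsCoordinate (f i) (t i)) ∧
      ∀ i j, ∃ (n : ℕ) (a : Γ(X, ⊤)), (f i * f j) ^ n • t i = a • t j := by
  let _ := sectionsAlgebraOfHom π
  obtain ⟨ι, U, t, hU, hcov, hiso, htrans⟩ := hπ.exists_triv
  -- Refines the charts to basic open sets; requiring f ≠ 0 keeps restriction to the chart
  -- injective.
  let s : Set Γ(X, ⊤) := {f | f ≠ 0 ∧ ∃ i, X.basicOpen f ≤ U i}
  have hs : Ideal.span s = ⊤ := by
    rw [← (isAffineOpen_top X).iSup_basicOpen_eq_self_iff, eq_top_iff]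
    intro x _
    have hx : x ∈ ⨆ i, U i := hcov ▸ trivial
    obtain ⟨i, hi⟩ := TopologicalSpace.Opens.mem_iSup.1 hx
    obtain ⟨_, ⟨_, ⟨f, rfl⟩, rfl⟩, hxf, hfU⟩ :=
      (isBasis_basicOpen X).exists_subset_of_mem_open hi (U i).isOpen
    refine TopologicalSpace.Opens.mem_iSup.2 ⟨⟨f, ?_, i, hfU⟩, hxf⟩
    rintro rfl
    simp at hxf
  obtain ⟨s', hs's, hs'⟩ := (Ideal.span_eq_top_iff_finite s).1 hs
  choose hf0 k hk using fun f : s' => hs's f.2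
  have hbij := fun i => bijective_of_isIso_localTriv π (hU i) (t i) (hiso i)
  have hpre : ∀ f : Γ(X, ⊤), π ⁻¹ᵁ X.basicOpen f = L.basicOpen (π.appTop f) := fun f =>
    Scheme.preimage_basicOpen_top π f
  have hUne : ∀ f : s', U (k f) ≠ ⊥ := fun f h => by
    have := hk f
    rw [h, le_bot_iff, basicOpen_eq_bot_iff] at this
    exact hf0 f this
  have hinj : ∀ f : s', Function.Injective (π.appTop) := by
    intro f a b hab
    apply res_injective (X := X) (le_top : U (k f) ≤ ⊤) (hUne f)
    apply C_injective
    apply (hbij (k f)).1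
    simp only [coe_eval₂RingHom, eval₂_C]
    have h := app_res π (le_top : U (k f) ≤ ⊤)
    exact (h a).trans ((congrArg _ hab).trans (h b).symm)
  have hpf : ∀ f : s', π.appTop (f : Γ(X, ⊤)) ≠ 0 := fun f h => by
    exact hf0 f ((map_eq_zero_iff _ (hinj f)).1 h)
  -- The coordinate lives only over the chart; a power of f extends it to a global function on L.
  have hext : ∀ f : s', ∃ (n : ℕ) (b : Γ(L, ⊤)), res (le_top : π ⁻¹ᵁ (U (k f)) ≤ ⊤) b =
      res le_top (π.appTop (f : Γ(X, ⊤))) ^ n * t (k f) := fun f =>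
    exists_res_eq_pow_mul (hpf f) (by rw [← hpre]; exact π.preimage_mono (hk f)) _
  choose m b hb using hext
  have hpne : ∀ (f : Γ(X, ⊤)) (V : X.Opens), π.appTop f ≠ 0 → X.basicOpen f ≤ V →
      π ⁻¹ᵁ V ≠ ⊥ := by
    intro f V hf hV h
    have := π.preimage_mono hV
    rw [h, hpre, le_bot_iff, basicOpen_eq_bot_iff] at this
    exact hf this
  refine ⟨s', inferInstance, fun f => f, b, ?_, fun f => ?_, fun f g => ?_⟩
  · simpa using hs'
  · let _ : Algebra Γ(X, ⊤) Γ(X, U (k f)) := (res le_top).toAlgebra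
    let _ : Algebra Γ(L, ⊤) Γ(L, π ⁻¹ᵁ U (k f)) := (res le_top).toAlgebra
    let _ : Algebra Γ(X, U (k f)) Γ(L, π ⁻¹ᵁ U (k f)) := (π.app (U (k f))).hom.toAlgebra
    let _ : Algebra Γ(X, ⊤) Γ(L, π ⁻¹ᵁ U (k f)) := ((res le_top).comp π.appTop.hom).toAlgebra
    have : IsScalarTower Γ(X, ⊤) Γ(L, ⊤) Γ(L, π ⁻¹ᵁ U (k f)) := .of_algebraMap_eq' rfl
    have : IsScalarTower Γ(X, ⊤) Γ(X, U (k f)) Γ(L, π ⁻¹ᵁ U (k f)) :=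
      .of_algebraMap_eq fun a => (app_res π (le_top : U (k f) ≤ ⊤) a).symm
    refine isCoordinate_of_bijective (C := Γ(X, U (k f))) (E := Γ(L, π ⁻¹ᵁ U (k f)))
      (t := t (k f)) (m := m f) (res_injective le_top (hUne f)) (res_injective le_top ?_) (hf0 f)
      (fun c => ?_) (hbij (k f)) ?_
    · exact hpne _ _ (hpf f) (hk f)
    · obtain ⟨n, a, h⟩ := exists_res_eq_pow_mul (hf0 f) (hk f) c
      refine ⟨n, a, ?_⟩
      rw [Algebra.smul_def, map_pow]
      exact h
    · rw [Algebra.smul_def, map_pow]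
      exact hb f
  · obtain ⟨c, -, hc⟩ := htrans (k f) (k g)
    have hfg : X.basicOpen ((f : Γ(X, ⊤)) * (g : Γ(X, ⊤))) ≤ U (k f) ⊓ U (k g) := by
      rw [Scheme.basicOpen_mul]
      exact inf_le_inf (hk f) (hk g)
    have hfg0 : (f : Γ(X, ⊤)) * (g : Γ(X, ⊤)) ≠ 0 := mul_ne_zero (hf0 f) (hf0 g)
    obtain ⟨n, a, ha⟩ := exists_res_eq_pow_mul hfg0 hfg c
    have ha' := congrArg (π.app (U (k f) ⊓ U (k g))) ha
    rw [map_mul, map_pow, app_res, app_res] at ha'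
    have hbf := congrArg (res (π.preimage_mono (inf_le_left : U (k f) ⊓ U (k g) ≤ _))) (hb f)
    have hbg := congrArg (res (π.preimage_mono (inf_le_right : U (k f) ⊓ U (k g) ≤ _))) (hb g)
    rw [map_mul, map_pow, res_res, res_res] at hbf hbg
    -- With b f = f ^ m f · t f, b g = g ^ m g · t g, t f = c t g and (f g) ^ n c = a, the extra
    -- factor (f g) ^ m g supplies the g ^ m g needed to form b g.
    refine ⟨n + m g, (f : Γ(X, ⊤)) ^ (m f + m g) * a, ?_⟩
    apply res_injective (le_top : π ⁻¹ᵁ (U (k f) ⊓ U (k g)) ≤ ⊤)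
      (hpne _ _ (by rw [map_mul]; exact mul_ne_zero (hpf f) (hpf g)) hfg)
    rw [Algebra.smul_def, Algebra.smul_def, map_mul, map_mul, hbf, hbg]
    change res _ (π.appTop _) * _ = res _ (π.appTop _) * _
    change res _ (π.appTop _) = res _ (π.appTop _) ^ n * _ at ha'
    change res _ (t (k f)) = _ * res _ (t (k g)) at hc
    rw [hc]
    simp only [map_mul, map_pow] at ha' ⊢
    rw [ha']
    ring

/-! ### Points and dense open sets -/

section Points

variable {X L : Scheme.{0}}

theorem appTop_ne_zero_of_pointIn {x : SpecC ⟶ X} {h : Γ(X, ⊤)} {U : X.Opens} (hx : PointIn x U)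
    (hU : U ≤ X.basicOpen h) : x.appTop h ≠ 0 := by
  intro h0
  obtain ⟨p⟩ : Nonempty SpecC := inferInstance
  have hp : p ∈ x ⁻¹ᵁ X.basicOpen h := hU (hx ⟨p, rfl⟩)
  rw [Scheme.preimage_basicOpen_top, h0, Scheme.basicOpen_zero] at hp
  exact hp

/-- V contains some D(f) with f ≠ 0, whose preimage is nonempty by injectivity of π on functions;
nonempty opens of the irreducible L are dense. -/
theorem dense_preimage [IsAffine X] [IsIntegral X] [IsIntegral L] {π : L ⟶ X}
    (hπ : Function.Injective π.appTop) {V : X.Opens} (hV : V ≠ ⊥) :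
    Dense ((π ⁻¹ᵁ V : L.Opens) : Set L) := by
  obtain ⟨x, hx⟩ : ∃ x, x ∈ V := by
    by_contra! hne
    exact hV (le_bot_iff.1 fun x hx => (hne x hx).elim)
  obtain ⟨_, ⟨_, ⟨f, rfl⟩, rfl⟩, hxf, hfV⟩ :=
    (isBasis_basicOpen X).exists_subset_of_mem_open hx V.isOpen
  refine (π ⁻¹ᵁ V).isOpen.dense ?_
  have hf : f ≠ 0 := by
    rintro rfl
    simp at hxf
  have hb : L.basicOpen (π.appTop f) ≠ ⊥ := by
    rw [Ne, basicOpen_eq_bot_iff]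
    exact (map_ne_zero_iff _ hπ).2 hf
  have hle : L.basicOpen (π.appTop f) ≤ π ⁻¹ᵁ V := by
    rw [← Scheme.preimage_basicOpen_top]
    exact π.preimage_mono hfV
  by_contra hne
  rw [Set.not_nonempty_iff_eq_empty] at hne
  refine hb (le_bot_iff.1 (hle.trans fun y hy => ?_))
  have : y ∈ (∅ : Set L) := hne ▸ hy
  exact this.elim

end Points

/-! ### Algebra structures over ℂ and projection of orbits -/

section Variety

variable {X L : Scheme.{0}} [X.Over SpecC] [L.Over SpecC]

theorem finiteType_sections [IsAffineVariety L] : Algebra.FiniteType ℂ Γ(L, ⊤) := by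
  have h1 : (L ↘ SpecC).appTop.hom.FiniteType := by
    have := (L ↘ SpecC).finiteType_appLE (isAffineOpen_top SpecC) (isAffineOpen_top L) le_top
    rwa [show (L ↘ SpecC).appLE ⊤ ⊤ le_top = (L ↘ SpecC).appTop from
      Scheme.Hom.appLE_eq_app _] at this
  have h2 : (Scheme.ΓSpecIso (CommRingCat.of ℂ)).inv.hom.FiniteType :=
    RingHom.FiniteType.of_surjective _
      (ConcreteCategory.bijective_of_isIso (Scheme.ΓSpecIso (CommRingCat.of ℂ)).inv).2
  exact h1.comp h2

theorem charZero_sections [IsAffineVariety X] : CharZero Γ(X, ⊤) :=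
  charZero_of_injective_algebraMap (algebraMap ℂ Γ(X, ⊤)).injective

theorem appTop_algebraMap {π : L ⟶ X} (hπ : π ≫ (X ↘ SpecC) = L ↘ SpecC) (c : ℂ) :
    π.appTop (algebraMap ℂ Γ(X, ⊤) c) = algebraMap ℂ Γ(L, ⊤) c := by
  rw [algebraMap_eq_appTop_over, algebraMap_eq_appTop_over]
  exact congrArg (fun g : L ⟶ SpecC => g.appTop ((Scheme.ΓSpecIso (CommRingCat.of ℂ)).inv c)) hπ

theorem isScalarTower_sections {π : L ⟶ X} (hπ : π ≫ (X ↘ SpecC) = L ↘ SpecC) :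
    let _ := sectionsAlgebraOfHom π
    IsScalarTower ℂ Γ(X, ⊤) Γ(L, ⊤) := by
  let _ := sectionsAlgebraOfHom π
  exact .of_algebraMap_eq fun c => (appTop_algebraMap hπ c).symm

/-- If a derivation `D'` of `𝒪(L)` extends `h D`, where `D h = 0`, then `π` maps the orbits of
`exp(D')` over `D(h)` onto orbits of `exp(D)`. -/
theorem image_orbit_expAction [IsAffine X] [IsAffine L] {π : L ⟶ X}
    (hπ : π ≫ (X ↘ SpecC) = L ↘ SpecC) {φ : GaAction X}
    {D : Derivation ℂ Γ(X, ⊤) Γ(X, ⊤)} (hD : IsLND D)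
    (hφ : ∀ (T : Scheme.{0}) (c : Γ(T, ⊤)) (x : T ⟶ X) (a : Γ(X, ⊤)),
      (linePoint c x ≫ φ.hom).appTop a = eval₂ x.appTop.hom c (expPoly hD a))
    {D' : Derivation ℂ Γ(L, ⊤) Γ(L, ⊤)} (hD' : IsLND D') {h : Γ(X, ⊤)} (hh : D h = 0)
    (hDD' : ∀ a, D' (π.appTop a) = π.appTop (h * D a)) (l : SpecC ⟶ L)
    (hl : (l ≫ π).appTop h ≠ 0) :
    (fun y => y ≫ π) '' (expAction hD').orbit l = φ.orbit (l ≫ π) := by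
  let i : ℂ →+* Γ(SpecC, ⊤) := (Scheme.ΓSpecIso (CommRingCat.of ℂ)).inv.hom
  have hi : Function.Surjective i :=
    (ConcreteCategory.bijective_of_isIso (Scheme.ΓSpecIso (CommRingCat.of ℂ)).inv).2
  obtain ⟨u, hu⟩ := hi ((l ≫ π).appTop h)
  have hu0 : u ≠ 0 := by
    rintro rfl
    exact hl (by rw [← hu, map_zero])
  have hiter : ∀ (n : ℕ) (a : Γ(X, ⊤)), D'^[n] (π.appTop a) = π.appTop (h ^ n * D^[n] a) := by
    intro n
    induction n with
    | zero => simp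
    | succ n ih =>
      intro a
      rw [Function.iterate_succ_apply, hDD', ih, iterate_derivation_mul_of_eq_zero D hh,
        Function.iterate_succ_apply, ← mul_assoc, pow_succ]
  -- Time X upstairs corresponds to time h X downstairs. At l the factor is the nonzero scalar u, so
  -- c ↦ u c is a bijection of times.
  have hexp : ∀ a, expPoly hD' (π.appTop a) =
      ((expPoly hD a).comp (C h * Polynomial.X)).map π.appTop.hom := by
    intro a
    ext n
    rw [coeff_expPoly, hiter, coeff_map, comp_C_mul_X_coeff, coeff_expPoly, Algebra.smul_def,
      Algebra.smul_def, ← appTop_algebraMap hπ, ← map_mul]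
    change π.appTop _ = π.appTop _
    congr 1
    ring
  have key : ∀ c, (linePoint (i c) l ≫ (expAction hD').hom) ≫ π =
      linePoint (i (u * c)) (l ≫ π) ≫ φ.hom := by
    intro c
    refine hom_ext_of_appTop fun a => ?_
    rw [hφ, Scheme.Hom.comp_appTop, CommRingCat.comp_apply]
    refine (linePoint_expHom_appTop hD' _ _ _).trans ?_
    rw [hexp, eval₂_map, ← CommRingCat.hom_comp, ← Scheme.Hom.comp_appTop, eval₂_comp, eval₂_mul,
      eval₂_C, eval₂_X, map_mul, hu]
  ext y
  constructor
  · rintro ⟨_, ⟨c, rfl⟩, rfl⟩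
    exact ⟨u * c, (key c).symm⟩
  · rintro ⟨c, rfl⟩
    refine ⟨_, ⟨u⁻¹ * c, rfl⟩, ?_⟩
    refine (key _).trans ?_
    rw [mul_inv_cancel_left₀ hu0]

end Variety

end LineBundleML

theorem mainTheorem5 (X L : Scheme.{0}) [X.Over LineBundleML.SpecC] [L.Over LineBundleML.SpecC]
    [LineBundleML.IsAffineVariety X] [LineBundleML.IsAffineVariety L]
    (π : L ⟶ X) (hπ : LineBundleML.IsLineBundle π) :
    (Smooth (X ↘ LineBundleML.SpecC) → ∀ φ : LineBundleML.GaAction X,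
      ∃ φ' : LineBundleML.GaAction L, φ'.Nontrivial ∧
        LineBundleML.GeneralOrbitsProjectOntoGeneric π φ' φ) ∧
    (LineBundleML.ML X = ⊥ → LineBundleML.ML L = ⊥) := by
  open LineBundleML in
  let _ := sectionsAlgebraOfHom π
  have : IsScalarTower ℂ Γ(X, ⊤) Γ(L, ⊤) := isScalarTower_sections hπ.comp_hom
  have : Algebra.FiniteType ℂ Γ(L, ⊤) := finiteType_sections
  have : CharZero Γ(X, ⊤) := charZero_sections
  obtain ⟨ι, _, f, t, hf, ht, htrans⟩ := hπ.exists_isCoordinate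
  obtain ⟨D₀, hD₀, hD₀nil, hD₀A, hD₀ker⟩ := exists_vertical_derivation (k := ℂ) hf ht
  have hinj : Function.Injective π.appTop := by
    have : Nonempty ι := by
      by_contra hne
      rw [not_nonempty_iff] at hne
      rw [Set.range_eq_empty, Ideal.span_empty] at hf
      exact bot_ne_top hf
    exact (ht (Classical.arbitrary ι)).algebraMap_injective
  refine ⟨fun _ φ => ?_, fun hML => ?_⟩
  · obtain ⟨D, hD, hφ⟩ := φ.exists_expPoly
    obtain ⟨h, D', h0, hDh, hD'nil, hD', hne⟩ : ∃ (h : Γ(X, ⊤)) (D' : Derivation ℂ Γ(L, ⊤) Γ(L, ⊤)),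
        h ≠ 0 ∧ D h = 0 ∧ IsLND D' ∧ (∀ a, D' (π.appTop a) = π.appTop (h * D a)) ∧ D' ≠ 0 := by
      -- A lift of the zero derivation might vanish, so the vertical one is used: its orbits stay in
      -- the fibres and project to the fixed points of φ.
      by_cases hDz : D = 0
      · refine ⟨1, D₀, one_ne_zero, D.map_one_eq_zero, hD₀nil, fun a => ?_, hD₀⟩
        rw [hDz, Derivation.zero_apply, mul_zero, map_zero]
        exact hD₀A a
      · obtain ⟨h, D', h0, hDh, hD'nil, hD'⟩ := exists_derivation_lift hf ht htrans hD
        refine ⟨h, D', h0, hDh, hD'nil, hD', ?_⟩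
        rintro rfl
        refine hDz (Derivation.ext fun a => ?_)
        have h1 : h * D a = 0 := (map_eq_zero_iff _ hinj).1 (hD' a).symm
        exact (mul_eq_zero.1 h1).resolve_left h0
    refine ⟨expAction hD'nil, expAction_nontrivial hD'nil hne, fun V hV => ?_⟩
    refine ⟨π ⁻¹ᵁ (V ⊓ X.basicOpen h), dense_preimage hinj fun hbot => ?_, fun l _ hlW => ?_⟩
    · have hb : X.basicOpen h ≠ ⊥ := by rwa [Ne, basicOpen_eq_bot_iff]
      refine hb (TopologicalSpace.Opens.ext ?_)
      have h1 : ((X.basicOpen h : X.Opens) : Set X) ∩ V = ∅ := by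
        rw [Set.inter_comm]
        exact congrArg (fun U : X.Opens => (U : Set X)) hbot
      by_contra hne'
      obtain ⟨y, hy⟩ := hV.inter_open_nonempty _ (X.basicOpen h).isOpen
        (Set.nonempty_iff_ne_empty.2 hne')
      rw [h1] at hy
      exact hy
    · have hlV : PointIn (l ≫ π) (V ⊓ X.basicOpen h) := by
        rintro _ ⟨p, rfl⟩
        have := hlW ⟨p, rfl⟩
        simpa using this
      refine ⟨hlV.trans fun _ hx => hx.1, ?_⟩
      exact image_orbit_expAction hπ.comp_hom hD hφ hD'nil hDh hD' l
        (appTop_ne_zero_of_pointIn hlV inf_le_right)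
  · rw [eq_bot_iff]
    intro b hb
    -- The vertical derivation brings b down to 𝒪(X); the lift of each D then gives h D a = 0 with h
    -- ≠ 0.
    obtain ⟨a, rfl⟩ := hD₀ker b (hb D₀ hD₀nil)
    have ha : a ∈ ML X := by
      intro D hD
      obtain ⟨h, D', h0, -, hD'nil, hD'⟩ := exists_derivation_lift hf ht htrans hD
      have h1 := hb D' hD'nil
      rw [hD'] at h1
      exact (mul_eq_zero.1 ((map_eq_zero_iff _ hinj).1 h1)).resolve_left h0
    rw [hML, Algebra.mem_bot] at ha
    obtain ⟨c, rfl⟩ := ha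
    rw [← IsScalarTower.algebraMap_apply]
    exact Subalgebra.algebraMap_mem _ c
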